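/- Let $n\ge 1$ and let $\mathbb{B}_n=\{z\in\mathbb{C}^n:|z|<1\}$ with volume measure $dv$ and $Rf(z)=\sum_{j=1}^n z_j\,\partial f/\partial z_j(z)$. For $0<p<\infty$ and real $\alpha$, let $dv_\alpha(z)=(1-|z|^2)^\alpha\,dv(z)$ and let $A^p_\alpha$ be the space of holomorphic functions $f$ in $\mathbb{B}_n$ such that $(1-|z|^2)^kR^kf(z)\in L^p(\mathbb{B}_n,dv_\alpha)$ for some nonnegative integer $k$ with $pk+\alpha>-1$. Put $$\|f\|_{p,\alpha}=|f(0)|+\left[\int_{\mathbb{B}_n}(1-|z|^2)^{pN}|R^Nf(z)|^p\,dv_\alpha(z)\right]^{1/p},$$ where $N$ is the smallest nonnegative integer with $pN+\alpha>-1$. **Theorem.** Suppose $n+1+\alpha=0$. 1. For every $0<p<\infty$, the space $A^p_\alpha$ is the diagonal Besov space $B_p$: for every positive integer $k$ with $pk>n$, a holomorphic function $f$ in $\mathbb{B}_n$ belongs to $A^p_\alpha$ if and only if $$\int_{\mathbb{B}_n}\bigl|(1-|z|^2)^kR^kf(z)\bigr|^p\,\frac{dv(z)}{(1-|z|^2)^{n+1}}<\infty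 .$$ 2. If $0<p\le 1$, then every $f\in A^p_\alpha$ extends continuously to the closed unit ball $\overline{\mathbb{B}_n}$. In particular, $f$ is bounded in $\mathbb{B}_n$. 3. If $1<p<\infty$ and $1/p+1/q=1$, then there exists a constant $C>0$, depending only on $n$ and $p$, such that $$|f(z)|\le C\,\|f\|_{p,\alpha}\left[\log\frac{2}{1-|z|^2}\right]^{1/q}$$ for all $f\in A^p_\alpha$ and all $z\in\mathbb{B}_n$. -/

import Mathlib

open MeasureTheory Set Metric

noncomputable section

/-- The complex Euclidean space `ℂⁿ` with its Euclidean norm. -/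
abbrev Cn (n : ℕ) : Type := EuclideanSpace ℂ (Fin n)

/-- The open unit ball of `ℂⁿ`. -/
def unitBall (n : ℕ) : Set (Cn n) := ball 0 1

/-- The radial derivative `R f (z) = ∑ⱼ zⱼ ∂f/∂zⱼ (z)`. The power `R^k` is `radialDeriv^[k]`. -/
def radialDeriv {n : ℕ} (f : Cn n → ℂ) : Cn n → ℂ :=
  fun z => ∑ j : Fin n, z j * fderiv ℂ f z (EuclideanSpace.single j 1)

/-- The measure `dv_α = (1 - |z|²)^α dv` on the unit ball, where `dv` is Lebesgue volume
(not normalized), for an arbitrary real `α`. -/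
def weightedVolume (n : ℕ) (α : ℝ) : Measure (Cn n) :=
  ((volume : Measure (Cn n)).restrict (unitBall n)).withDensity
    (fun z => ENNReal.ofReal ((1 - ‖z‖ ^ 2) ^ α))

/-- The Möbius invariant measure `dτ = dv / (1 - |z|²)^(n+1)` on the unit ball. -/
def invariantMeasure (n : ℕ) : Measure (Cn n) :=
  ((volume : Measure (Cn n)).restrict (unitBall n)).withDensity
    (fun z => ENNReal.ofReal (1 / (1 - ‖z‖ ^ 2) ^ (n + 1)))

/-- The generalized weighted Bergman space `A^p_α`, for `0 < p < ∞` and `α` real: the functions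
`f` holomorphic in the unit ball such that `(1 - |z|²)^k R^k f` is in `L^p(dv_α)` for some
nonnegative integer `k` with `p k + α > -1`. Functions on the ball are represented by functions
on `ℂⁿ`, whose values off the ball play no role. -/
def bergmanSpace (n : ℕ) (p α : ℝ) : Set (Cn n → ℂ) :=
  {f | DifferentiableOn ℂ f (unitBall n) ∧
    ∃ k : ℕ, -1 < p * k + α ∧
      MemLp (fun z => ((1 - ‖z‖ ^ 2 : ℝ) : ℂ) ^ k * radialDeriv^[k] f z)
        (ENNReal.ofReal p) (weightedVolume n α)}

/-- The (quasi-)norm `‖f‖_{p,α} = |f(0)| + [∫ (1 - |z|²)^(pN) |R^N f|^p dv_α]^(1/p)` of `A^p_α`,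
where `N` is the smallest nonnegative integer with `p N + α > -1`. -/
def bergmanNorm (n : ℕ) (p α : ℝ) (f : Cn n → ℂ) : ℝ :=
  let N : ℕ := sInf {N : ℕ | -1 < p * N + α}
  ‖f 0‖ + (∫ z, (1 - ‖z‖ ^ 2) ^ (p * N) * ‖radialDeriv^[N] f z‖ ^ p ∂weightedVolume n α) ^ (1 / p)

/-- The diagonal Besov space `B_p`, defined with derivatives of order `k`: the functions `f`
holomorphic in the unit ball with `∫ |(1 - |z|²)^k R^k f(z)|^p dτ(z) < ∞`. Here `k` is meant to be
a positive integer with `p k > n`. -/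
def besovSpace (n : ℕ) (p : ℝ) (k : ℕ) : Set (Cn n → ℂ) :=
  {f | DifferentiableOn ℂ f (unitBall n) ∧
    ∫⁻ z, ENNReal.ofReal (‖((1 - ‖z‖ ^ 2 : ℝ) : ℂ) ^ k * radialDeriv^[k] f z‖ ^ p)
      ∂invariantMeasure n < ⊤}

end

noncomputable section

/-! In logarithmic coordinates `R` is plain differentiation: `R g(z)` is the derivative of `ζ ↦
g(e^ζ z)` at `0`. So most of the work happens on the complex lines through the origin, with `log
(1/|z|)` in place of `1 - |z|²` away from the origin. Every pointwise bound comes from the sub-mean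
value property of `|g|^p`, valid for all `p > 0`.

Membership does not depend on `k`: for `b > -1`, `∫ (1-|z|²)^(b+p) |R g|^p` and `∫ (1-|z|²)^b |g|^p`
are finite together (`ballIntegral_radialDeriv_lt_top_iff`). In both directions the integrand at `z`
is bounded by an average over a cone with vertex `z` (`expAverage`), and Fubini turns weighted
integrals of such averages into weighted volume integrals (`lintegral_rpow_mul_expAverage_le`).
Passing from `g` to `R g` is a Cauchy estimate in one disc. Passing back integrates `R g` along a
radius, at the price of a factor `t^(-ε)` that the strict inequality `b > -1` can absorb. With `b =
pk - n - 1` the condition on `b` is `pk > n`.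

Growth and continuity rest on a bound along rays. The mean value property on a nonisotropic ball of
volume about `(1-ρ)^(n+1)` at `ρe`, integrated against `dρ/(1-ρ)`, gives `∫ (1-ρ)^(pk-1) |R^k
f(ρe)|^p dρ ≤ C ∫ |(1-|z|²)^k R^k f|^p dτ`, uniformly in the unit vector `e`
(`setLIntegral_ray_le`). Taylor's formula in `log r` writes `f(re)` as a polynomial plus an integral
with kernel `O((1-ρ)^(k-1))` against `R^k f`. If `p ≤ 1`, the pointwise bound on `(1-ρ)^k R^k f`
trades the first power for the `p`-th, so the remainder is uniformly small near the sphere and `f`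
extends continuously. If `p > 1`, Hölder's inequality leaves `(∫ dρ/(1-ρ))^(1/q)`, which is the
logarithm. -/

theorem radialDeriv_eq_fderiv {n : ℕ} (f : Cn n → ℂ) (z : Cn n) :
    radialDeriv f z = fderiv ℂ f z z := by
  have h : z = ∑ j : Fin n, z j • EuclideanSpace.single j (1 : ℂ) := by
    have := (EuclideanSpace.basisFun (Fin n) ℂ).sum_repr z
    simpa using this.symm
  conv_rhs => rw [h]
  rw [map_sum]
  unfold radialDeriv
  refine Finset.sum_congr rfl fun j _ => ?_
  rw [map_smul, smul_eq_mul, ← h]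

/-! ### Complex linear changes of variables and the sub-mean value property of `|G|^p`. -/

section

variable {E : Type*} [NormedAddCommGroup E] [NormedSpace ℂ E] [MeasurableSpace E] [BorelSpace E]
  [FiniteDimensional ℂ E] (μ : Measure E) [μ.IsAddHaarMeasure]

theorem lintegral_comp_linearMap (T : E →ₗ[ℂ] E) (hT : LinearMap.det T ≠ 0) (F : E → ENNReal) :
    ∫⁻ x, F (T x) ∂μ = ENNReal.ofReal ((‖LinearMap.det T‖ ^ 2)⁻¹) * ∫⁻ x, F x ∂μ := by
  have : FiniteDimensional ℝ E := FiniteDimensional.complexToReal E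
  have hdet : LinearMap.det (T.restrictScalars ℝ) = ‖LinearMap.det T‖ ^ 2 := by
    rw [LinearMap.det_restrictScalars, Algebra.norm_complex_apply, Complex.normSq_eq_norm_sq]
  have hne : LinearMap.det (T.restrictScalars ℝ) ≠ 0 := by
    rw [hdet]; positivity
  have hmap := Measure.map_linearMap_addHaar_eq_smul_addHaar μ hne
  let e := (LinearMap.equivOfDetNeZero _ hT).toContinuousLinearEquiv
  have he : ∀ x, e x = T x := fun x => rfl
  have hemb : MeasurableEmbedding (fun x => T x) := by
    have := e.toHomeomorph.measurableEmbedding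
    exact this
  have : ∫⁻ x, F x ∂(Measure.map (fun x => T x) μ) = ∫⁻ x, F (T x) ∂μ :=
    hemb.lintegral_map _
  rw [← this]
  have h2 : Measure.map (fun x => T x) μ = ENNReal.ofReal ((‖LinearMap.det T‖ ^ 2)⁻¹) • μ := by
    have h3 : (fun x => T x) = (T.restrictScalars ℝ : E →ₗ[ℝ] E) := rfl
    rw [h3, hmap, hdet, abs_of_nonneg (by positivity)]
  rw [h2, lintegral_smul_measure, smul_eq_mul]

theorem lintegral_comp_complex_smul {c : ℂ} (hc : c ≠ 0) (F : E → ENNReal) :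
    ∫⁻ x, F (c • x) ∂μ =
      ENNReal.ofReal ((‖c‖ ^ (2 * Module.finrank ℂ E))⁻¹) * ∫⁻ x, F x ∂μ := by
  have hd : LinearMap.det (c • (LinearMap.id : E →ₗ[ℂ] E)) = c ^ Module.finrank ℂ E := by
    rw [LinearMap.det_smul, LinearMap.det_id, mul_one]
  have := lintegral_comp_linearMap μ (c • (LinearMap.id : E →ₗ[ℂ] E))
    (by rw [hd]; exact pow_ne_zero _ hc) F
  rw [hd] at this
  simp only [LinearMap.smul_apply, LinearMap.id_apply] at this
  rw [this, norm_pow, ← pow_mul, mul_comm 2]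

end

/-- Jensen's formula gives `log |h 0| ≤` the circle average of `log |h|`; the convexity of `exp`
then passes to the `p`-th power. This covers `p < 1`, where no triangle inequality is available. -/
theorem norm_rpow_le_circle_integral {h : ℂ → ℂ} {p : ℝ} (hp : 0 < p)
    (hh : AnalyticOnNhd ℂ h (closedBall 0 1)) :
    2 * Real.pi * ‖h 0‖ ^ p ≤ ∫ θ in (0)..(2 * Real.pi), ‖h (circleMap 0 1 θ)‖ ^ p := by
  by_cases h0 : h 0 = 0
  · rw [h0, norm_zero, Real.zero_rpow hp.ne', mul_zero]
    exact intervalIntegral.integral_nonneg (by positivity) fun θ _ => by positivity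
  have hh1 : AnalyticOnNhd ℂ h (closedBall 0 |1|) := by simpa using hh
  have hsph : AnalyticOnNhd ℂ h (sphere 0 |1|) := hh1.mono sphere_subset_closedBall
  have jensen := hh1.circleAverage_log_norm one_ne_zero h0
  have hlog : Real.log ‖h 0‖ ≤ Real.circleAverage (fun z => Real.log ‖h z‖) 0 1 := by
    rw [jensen]
    refine le_add_of_nonneg_left (finsum_nonneg fun u => ?_)
    by_cases hu : u ∈ closedBall (0 : ℂ) |1|
    · refine mul_nonneg (mod_cast MeromorphicOn.AnalyticOnNhd.divisor_nonneg hh1 ..) ?_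
      have hu1 : ‖u‖ ≤ 1 := by simpa using hu
      rcases eq_or_ne u 0 with rfl | hu0
      · simp
      · refine Real.log_nonneg ?_
        rw [one_mul, zero_sub, norm_neg]
        exact (one_le_inv₀ (norm_pos_iff.mpr hu0)).mpr hu1
    · rw [Function.locallyFinsuppWithin.apply_eq_zero_of_notMem _ hu]
      simp
  have hint : CircleIntegrable (fun z => Real.log ‖h z‖) 0 1 :=
    hsph.meromorphicOn.circleIntegrable_log_norm
  have hcont : Continuous fun θ : ℝ => h (circleMap 0 1 θ) := by
    refine hsph.continuousOn.comp_continuous (continuous_circleMap 0 1) fun θ => ?_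
    simp
  have hne : ∀ᵐ θ : ℝ ∂volume.restrict (Set.Icc 0 (2 * Real.pi)), h (circleMap 0 1 θ) ≠ 0 := by
    have h1 : h ⁻¹' {0}ᶜ ∈ Filter.codiscreteWithin (closedBall (0 : ℂ) |1|) :=
      hh1.preimage_zero_mem_codiscreteWithin (x := 0) h0 (by simp)
        (by
          have := (convex_closedBall (0 : ℂ) |1|).isPreconnected
          exact ⟨⟨0, by simp⟩, this⟩)
    have h2 : h ⁻¹' {0}ᶜ ∈ Filter.codiscreteWithin (sphere (0 : ℂ) |1|) :=
      Filter.codiscreteWithin_mono sphere_subset_closedBall h1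
    have h3 := circleMap_preimage_codiscrete (c := 0) (one_ne_zero) h2
    have h4 := Filter.codiscreteWithin_mono (Set.subset_univ (Set.Icc 0 (2 * Real.pi))) h3
    exact ae_restrict_le_codiscreteWithin measurableSet_Icc h4
  set m := p * Real.log ‖h 0‖ with hm
  have hexp : ‖h 0‖ ^ p = Real.exp m := by
    rw [Real.rpow_def_of_pos (norm_pos_iff.mpr h0), hm, mul_comm]
  -- Tangent line of `exp` at `m = p log |h 0|`. It is used where `h ≠ 0`, which is almost
  -- everywhere on the circle.
  have key : ∫ θ in (0)..(2 * Real.pi),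
      Real.exp m * (1 - m + p * Real.log ‖h (circleMap 0 1 θ)‖) ≤
      ∫ θ in (0)..(2 * Real.pi), ‖h (circleMap 0 1 θ)‖ ^ p := by
    refine intervalIntegral.integral_mono_ae_restrict (by positivity) ?_ ?_ ?_
    · exact (intervalIntegrable_const.add (hint.const_mul p)).const_mul _
    · exact (hcont.norm.rpow_const fun _ => Or.inr hp.le).intervalIntegrable _ _
    · filter_upwards [hne] with θ hθ
      rw [Real.rpow_def_of_pos (norm_pos_iff.mpr hθ), mul_comm (Real.log _) p]
      have := Real.add_one_le_exp (p * Real.log ‖h (circleMap 0 1 θ)‖ - m)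
      calc _ ≤ Real.exp m * Real.exp (p * Real.log ‖h (circleMap 0 1 θ)‖ - m) := by
            gcongr; linarith
        _ = _ := by rw [← Real.exp_add]; ring_nf
  refine le_trans ?_ key
  rw [intervalIntegral.integral_const_mul, intervalIntegral.integral_add
    intervalIntegrable_const (hint.const_mul p), intervalIntegral.integral_const,
    intervalIntegral.integral_const_mul, hexp]
  have h5 : ∫ θ in (0)..(2 * Real.pi), Real.log ‖h (circleMap 0 1 θ)‖ =
      2 * Real.pi * Real.circleAverage (fun z => Real.log ‖h z‖) 0 1 := by
    rw [Real.circleAverage, smul_eq_mul]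
    field_simp
  rw [h5, sub_zero, smul_eq_mul]
  have h6 : m ≤ p * Real.circleAverage (fun z => Real.log ‖h z‖) 0 1 := by
    rw [hm]; gcongr
  have h7 : 0 < Real.exp m := Real.exp_pos m
  have h8 : 0 < 2 * Real.pi := by positivity
  nlinarith [mul_nonneg (mul_pos h8 h7).le (sub_nonneg.mpr h6)]

section

variable {E : Type*} [NormedAddCommGroup E] [NormedSpace ℂ E]

theorem measurable_indicator_enorm_rpow {E : Type*} [TopologicalSpace E] [MeasurableSpace E] [BorelSpace E] {G : E → ℂ} {s : Set E}
    (hs : MeasurableSet s) (hG : ContinuousOn G s) (p : ℝ) :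
    Measurable (s.indicator fun x => ‖G x‖ₑ ^ p) := by
  classical
  have h1 : Measurable (s.piecewise G fun _ => 0) :=
    ContinuousOn.measurable_piecewise hG continuous_const.continuousOn hs
  have h2 : (s.indicator fun x => ‖G x‖ₑ ^ p) =
      s.indicator fun x => ‖s.piecewise G (fun _ => 0) x‖ₑ ^ p := by
    ext x
    by_cases hx : x ∈ s <;> simp [hx]
  rw [h2]
  exact (h1.enorm.pow_const p).indicator hs

theorem circle_enorm_rpow_le {G : E → ℂ} {p : ℝ} (hp : 0 < p)
    (hG : DifferentiableOn ℂ G (ball 0 1)) {x : E} (hx : x ∈ ball (0 : E) 1) :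
    ENNReal.ofReal (2 * Real.pi) * ‖G 0‖ₑ ^ p ≤
      ∫⁻ θ in Set.Ioc (0 : ℝ) (2 * Real.pi), ‖G (circleMap 0 1 θ • x)‖ₑ ^ p := by
  have hx1 : ‖x‖ < 1 := by simpa using hx
  set h : ℂ → ℂ := fun l => G (l • x) with hh
  obtain ⟨r, hr1, hr⟩ : ∃ r : ℝ, 1 < r ∧ r * ‖x‖ < 1 := by
    rcases eq_or_ne x 0 with rfl | hx0
    · exact ⟨2, by norm_num, by simp⟩
    · have hpos := norm_pos_iff.mpr hx0
      refine ⟨(1 + ‖x‖⁻¹) / 2, ?_, ?_⟩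
      · have := (one_lt_inv₀ hpos).mpr hx1; linarith
      · field_simp; linarith
  have hd : DifferentiableOn ℂ h (ball 0 r) := by
    refine hG.comp (by fun_prop) fun l hl => ?_
    have hl : ‖l‖ < r := by simpa using hl
    rw [mem_ball_zero_iff, norm_smul]
    exact lt_of_le_of_lt (by gcongr) hr
  have han : AnalyticOnNhd ℂ h (closedBall 0 1) :=
    (hd.analyticOnNhd isOpen_ball).mono (closedBall_subset_ball hr1)
  have hmain := norm_rpow_le_circle_integral hp han
  have hcont : Continuous fun θ : ℝ => h (circleMap 0 1 θ) :=
    han.continuousOn.comp_continuous (continuous_circleMap 0 1) fun θ => by simp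
  have hconv : ∀ y : ℂ, ‖y‖ₑ ^ p = ENNReal.ofReal (‖y‖ ^ p) := fun y => by
    rw [← ofReal_norm, ENNReal.ofReal_rpow_of_nonneg (norm_nonneg _) hp.le]
  have hint : IntegrableOn (fun θ : ℝ => ‖h (circleMap 0 1 θ)‖ ^ p)
      (Set.Ioc (0 : ℝ) (2 * Real.pi)) :=
    ((hcont.norm.rpow_const fun _ => Or.inr hp.le).intervalIntegrable 0 (2 * Real.pi)).1
  calc _ = ENNReal.ofReal (2 * Real.pi * ‖h 0‖ ^ p) := by
        rw [hconv, ← ENNReal.ofReal_mul (by positivity), hh]; simp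
    _ ≤ ENNReal.ofReal (∫ θ in (0)..(2 * Real.pi), ‖h (circleMap 0 1 θ)‖ ^ p) :=
        ENNReal.ofReal_le_ofReal hmain
    _ = _ := by
        rw [intervalIntegral.integral_of_le (by positivity),
          ofReal_integral_eq_lintegral_ofReal hint (ae_of_all _ fun _ => by positivity)]
        refine lintegral_congr fun θ => ?_
        rw [hconv]

variable [MeasurableSpace E] [BorelSpace E] [FiniteDimensional ℂ E] (μ : Measure E)
  [μ.IsAddHaarMeasure]

/-- Averaging over the rotations `x ↦ e^(iθ) x`, which preserve the measure, reduces the claim to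
the one-variable inequality on each slice; no polar coordinates are needed. -/
theorem enorm_rpow_mul_measure_ball_le {G : E → ℂ} {p : ℝ} (hp : 0 < p)
    (hG : DifferentiableOn ℂ G (ball 0 1)) :
    ‖G 0‖ₑ ^ p * μ (ball 0 1) ≤ ∫⁻ x in ball 0 1, ‖G x‖ₑ ^ p ∂μ := by
  have : FiniteDimensional ℝ E := FiniteDimensional.complexToReal E
  have : ProperSpace E := FiniteDimensional.proper ℝ E
  have : SecondCountableTopology E := inferInstance
  set F : E → ENNReal := (ball (0 : E) 1).indicator fun x => ‖G x‖ₑ ^ p with hF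
  have hFm : Measurable F := measurable_indicator_enorm_rpow measurableSet_ball hG.continuousOn p
  have hrot : ∀ θ : ℝ, ∫⁻ x, F (circleMap 0 1 θ • x) ∂μ = ∫⁻ x, F x ∂μ := fun θ => by
    rw [lintegral_comp_complex_smul μ (by simp)]
    simp
  have hpi : ENNReal.ofReal (2 * Real.pi) ≠ 0 := by simp [Real.pi_pos]
  rw [← lintegral_indicator measurableSet_ball, ← hF]
  rw [← ENNReal.mul_le_mul_iff_right hpi ENNReal.ofReal_ne_top]
  calc _ = ∫⁻ x in ball 0 1, ENNReal.ofReal (2 * Real.pi) * ‖G 0‖ₑ ^ p ∂μ := by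
        rw [setLIntegral_const, mul_assoc]
    _ ≤ ∫⁻ x in ball 0 1, (∫⁻ θ in Set.Ioc (0 : ℝ) (2 * Real.pi), F (circleMap 0 1 θ • x)) ∂μ := by
        refine setLIntegral_mono' measurableSet_ball fun x hx => ?_
        refine (circle_enorm_rpow_le hp hG hx).trans_eq (lintegral_congr fun θ => ?_)
        rw [hF, indicator_of_mem]
        simpa [norm_smul] using hx
    _ ≤ ∫⁻ x, (∫⁻ θ in Set.Ioc (0 : ℝ) (2 * Real.pi), F (circleMap 0 1 θ • x)) ∂μ :=
        setLIntegral_le_lintegral _ _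
    _ = ∫⁻ θ in Set.Ioc (0 : ℝ) (2 * Real.pi), ∫⁻ x, F (circleMap 0 1 θ • x) ∂μ := by
        refine lintegral_lintegral_swap ?_
        refine (hFm.comp ?_).aemeasurable
        have : Continuous fun q : E × ℝ => circleMap 0 1 q.2 • q.1 := by fun_prop
        exact this.measurable
    _ = _ := by
        simp_rw [hrot]
        rw [setLIntegral_const, Real.volume_Ioc, sub_zero, mul_comm]

end


/-! ### Holomorphy of the radial derivatives. -/

/-- `R f(z)` is the derivative of `l ↦ f(lz)` at `l = 1`, hence a Cauchy integral over a small
circle about `1`. The integrand is holomorphic in `z`, and one differentiates under the integral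
sign. -/
theorem differentiableOn_radialDeriv {n : ℕ} {f : Cn n → ℂ}
    (hf : DifferentiableOn ℂ f (unitBall n)) : DifferentiableOn ℂ (radialDeriv f) (unitBall n) := by
  intro z₀ hz₀
  have hz₀' : ‖z₀‖ < 1 := by simpa [unitBall] using hz₀
  -- A quarter of the distance to the sphere: `|z| ≤ 1 - 3ε` and `|l| ≤ 1 + ε` give `|lz| ≤ 1 - 2ε`,
  -- which leaves a further `ε` for the Cauchy bound on `fderiv`.
  set ε := (1 - ‖z₀‖) / 4 with hε
  have hε0 : 0 < ε := by rw [hε]; linarith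
  have hz₀e : ‖z₀‖ = 1 - 4 * ε := by rw [hε]; ring
  have hε1 : ε ≤ 1 / 4 := by have := norm_nonneg z₀; linarith
  have hopen : IsOpen (unitBall n) := isOpen_ball
  have hmem : ∀ w : Cn n, ‖w‖ < 1 → w ∈ unitBall n := fun w hw => by simpa [unitBall] using hw
  have hdiff : ∀ w : Cn n, ‖w‖ < 1 → DifferentiableAt ℂ f w := fun w hw =>
    hf.differentiableAt (hopen.mem_nhds (hmem w hw))
  obtain ⟨M, hM⟩ : ∃ M, ∀ w ∈ closedBall (0 : Cn n) (1 - ε), ‖f w‖ ≤ M := by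
    refine (isCompact_closedBall _ _).exists_bound_of_continuousOn (hf.continuousOn.mono ?_)
    exact closedBall_subset_ball (by linarith)
  have hfd : ∀ w : Cn n, ‖w‖ ≤ 1 - 2 * ε → ‖fderiv ℂ f w‖ ≤ 2 * M / ε := fun w hw => by
    have hsub : ∀ x ∈ ball w ε, ‖x‖ ≤ 1 - ε := fun x hx => by
      rw [mem_ball_iff_norm] at hx
      have : ‖x‖ ≤ ‖x - w‖ + ‖w‖ := by simpa using norm_add_le (x - w) w
      linarith
    refine Complex.norm_fderiv_le_div_of_mapsTo_ball
      (hf.mono fun x hx => hmem x (by linarith [hsub x hx])) (fun x hx => ?_) hε0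
    rw [mem_closedBall, dist_eq_norm]
    have h1 := hM x (by simpa using hsub x hx)
    have h2 := hM w (by simpa using hsub w (mem_ball_self hε0))
    linarith [norm_sub_le (f x) (f w)]
  have hc : ∀ θ : ℝ, ‖circleMap 1 ε θ‖ ≤ 1 + ε := fun θ => by
    have h1 : ‖circleMap 1 ε θ - 1‖ = ε := by
      rw [circleMap_sub_center, norm_circleMap_zero, abs_of_pos hε0]
    have h2 : ‖circleMap 1 ε θ‖ ≤ ‖circleMap 1 ε θ - 1‖ + ‖(1 : ℂ)‖ := by
      simpa only [sub_add_cancel] using norm_add_le (circleMap 1 ε θ - 1) (1 : ℂ)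
    rw [norm_one] at h2; linarith
  have hzn : ∀ z ∈ ball z₀ ε, ‖z‖ ≤ 1 - 3 * ε := fun z hz => by
    rw [mem_ball_iff_norm] at hz
    have : ‖z‖ ≤ ‖z - z₀‖ + ‖z₀‖ := by simpa using norm_add_le (z - z₀) z₀
    linarith
  have hsmul : ∀ l : ℂ, ‖l‖ ≤ 1 + ε → ∀ z ∈ ball z₀ ε, ‖l • z‖ ≤ 1 - 2 * ε := fun l hl z hz => by
    rw [norm_smul]
    calc ‖l‖ * ‖z‖ ≤ (1 + ε) * (1 - 3 * ε) := by
          gcongr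
          exact hzn z hz
      _ ≤ 1 - 2 * ε := by nlinarith
  set k : ℝ → ℂ := fun θ => deriv (circleMap 1 ε) θ * (1 / (circleMap 1 ε θ - 1) ^ 2) with hk
  have hkn : ∀ θ, ‖k θ‖ = 1 / ε := fun θ => by
    simp only [hk, circleMap_sub_center, deriv_circleMap, norm_mul, norm_div, norm_pow,
      norm_circleMap_zero, Complex.norm_I, abs_of_pos hε0, norm_one]
    field_simp
  have hkc : Continuous k := by
    simp only [hk, circleMap_sub_center, deriv_circleMap]
    refine Continuous.mul (by fun_prop) (Continuous.div (by fun_prop) (by fun_prop) fun θ => ?_)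
    exact pow_ne_zero _ (circleMap_ne_center hε0.ne')
  have hrep : ∀ z ∈ ball z₀ ε, radialDeriv f z =
      (2 * Real.pi * Complex.I)⁻¹ •
        ∫ θ in (0)..(2 * Real.pi), k θ • f (circleMap 1 ε θ • z) := fun z hz => by
    have hd : DifferentiableOn ℂ (fun l : ℂ => f (l • z)) (closedBall 1 ε) := by
      refine hf.comp (by fun_prop) fun l hl => hmem _ ?_
      have hl2 : ‖l‖ ≤ 1 + ε := by
        rw [mem_closedBall_iff_norm] at hl
        have h2 : ‖l‖ ≤ ‖l - 1‖ + ‖(1 : ℂ)‖ := by simpa using norm_add_le (l - 1) (1 : ℂ)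
        rw [norm_one] at h2; linarith
      have := hsmul l hl2 z hz
      linarith
    have h1 := hd.deriv_eq_smul_circleIntegral hε0
    have h2 : deriv (fun l : ℂ => f (l • z)) 1 = radialDeriv f z := by
      rw [radialDeriv_eq_fderiv]
      have h3 : HasFDerivAt f (fderiv ℂ f z) ((1 : ℂ) • z) := by
        rw [one_smul]; exact (hdiff z (by linarith [hzn z hz])).hasFDerivAt
      have h4 : HasDerivAt (fun l : ℂ => l • z) ((1 : ℂ) • z) 1 :=
        (hasDerivAt_id (1 : ℂ)).smul_const z
      have h5 := h3.comp_hasDerivAt (1 : ℂ) h4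
      rw [one_smul] at h5
      exact h5.deriv
    rw [h2] at h1
    rw [eq_inv_smul_iff₀ (by simp [Real.pi_ne_zero]), ← h1, circleIntegral]
    refine intervalIntegral.integral_congr fun θ _ => ?_
    simp only [hk, smul_eq_mul, mul_assoc]
  have hcont : ∀ z ∈ ball z₀ ε, Continuous fun θ : ℝ => k θ • f (circleMap 1 ε θ • z) :=
    fun z hz => by
      refine hkc.smul (hf.continuousOn.comp_continuous (by fun_prop) fun θ => hmem _ ?_)
      have := hsmul _ (hc θ) z hz
      linarith
  have hmain := intervalIntegral.hasFDerivAt_integral_of_dominated_of_fderiv_le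
    (𝕜 := ℂ) (μ := volume) (x₀ := z₀) (s := ball z₀ ε) (a := 0) (b := 2 * Real.pi)
    (F := fun z θ => k θ • f (circleMap 1 ε θ • z))
    (F' := fun z θ => (k θ * circleMap 1 ε θ) • fderiv ℂ f (circleMap 1 ε θ • z))
    (bound := fun _ => 1 / ε * 2 * (2 * M / ε))
    (ball_mem_nhds z₀ hε0)
    (by
      filter_upwards [ball_mem_nhds z₀ hε0] with z hz
      exact (hcont z hz).aestronglyMeasurable)
    ((hcont z₀ (mem_ball_self hε0)).intervalIntegrable _ _)
    (by
      have h1 : Measurable fun θ : ℝ => fderiv ℂ f (circleMap 1 ε θ • z₀) :=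
        (measurable_fderiv ℂ f).comp (by fun_prop : Continuous _).measurable
      exact ((hkc.mul (continuous_circleMap 1 ε)).measurable.smul h1).aestronglyMeasurable)
    (ae_of_all _ fun θ _ z hz => by
      rw [norm_smul, norm_mul, hkn]
      have := hfd _ (hsmul _ (hc θ) z hz)
      gcongr
      linarith [hc θ])
    intervalIntegrable_const
    (ae_of_all _ fun θ _ z hz => by
      have h1 : HasFDerivAt f (fderiv ℂ f (circleMap 1 ε θ • z)) (circleMap 1 ε θ • z) :=
        (hdiff _ (by linarith [hsmul _ (hc θ) z hz])).hasFDerivAt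
      have h2 : HasFDerivAt (fun z : Cn n => circleMap 1 ε θ • z)
          (circleMap 1 ε θ • ContinuousLinearMap.id ℂ (Cn n)) z :=
        (circleMap 1 ε θ • ContinuousLinearMap.id ℂ (Cn n)).hasFDerivAt
      have h3 := (h1.comp z h2).const_smul (k θ)
      refine HasFDerivAt.congr_fderiv h3 ?_
      apply ContinuousLinearMap.ext
      intro v
      simp [mul_assoc])
  have hd := (hmain.const_smul (2 * Real.pi * Complex.I)⁻¹).differentiableAt
  refine (hd.congr_of_eventuallyEq ?_).differentiableWithinAt
  filter_upwards [ball_mem_nhds z₀ hε0] with z hz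
  exact hrep z hz

theorem differentiableOn_iterate_radialDeriv {n : ℕ} {f : Cn n → ℂ}
    (hf : DifferentiableOn ℂ f (unitBall n)) (k : ℕ) :
    DifferentiableOn ℂ (radialDeriv^[k] f) (unitBall n) := by
  induction k with
  | zero => exact hf
  | succ k ih =>
    rw [Function.iterate_succ_apply']
    exact differentiableOn_radialDeriv ih

/-! ### Mean value and Cauchy estimates on discs and ellipsoids. -/

/-- The mean value property on the unit ball, transported by the affine map `x ↦ u + T x`; an
ellipsoid is as good as a ball because `T` is complex linear. -/
theorem enorm_rpow_mul_le_setLIntegral {E : Type*} [NormedAddCommGroup E] [NormedSpace ℂ E]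
    [MeasurableSpace E] [BorelSpace E] [FiniteDimensional ℂ E] (μ : Measure E) [μ.IsAddHaarMeasure]
    {G : E → ℂ} {p : ℝ} (hp : 0 < p) {S : Set E} (hS : MeasurableSet S)
    (hG : DifferentiableOn ℂ G S) {u : E} {T : E →ₗ[ℂ] E} (hT : LinearMap.det T ≠ 0)
    (hTS : ∀ x ∈ ball (0 : E) 1, u + T x ∈ S) :
    ‖G u‖ₑ ^ p * (ENNReal.ofReal (‖LinearMap.det T‖ ^ 2) * μ (ball 0 1)) ≤
      ∫⁻ w in S, ‖G w‖ₑ ^ p ∂μ := by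
  have hd : 0 < ‖LinearMap.det T‖ ^ 2 := by positivity
  have hd' : ENNReal.ofReal (‖LinearMap.det T‖ ^ 2) *
      ENNReal.ofReal ((‖LinearMap.det T‖ ^ 2)⁻¹) = 1 := by
    rw [← ENNReal.ofReal_mul hd.le, mul_inv_cancel₀ hd.ne', ENNReal.ofReal_one]
  have hc : DifferentiableOn ℂ (fun x => G (u + T x)) (ball 0 1) := by
    refine hG.comp ?_ hTS
    exact ((LinearMap.toContinuousLinearMap T).differentiable.const_add u).differentiableOn
  have h1 := enorm_rpow_mul_measure_ball_le μ hp hc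
  rw [map_zero, add_zero] at h1
  have h2 : ∫⁻ x in ball 0 1, ‖G (u + T x)‖ₑ ^ p ∂μ ≤
      ENNReal.ofReal ((‖LinearMap.det T‖ ^ 2)⁻¹) * ∫⁻ w in S, ‖G w‖ₑ ^ p ∂μ := by
    rw [← lintegral_indicator hS,
      ← lintegral_add_left_eq_self (μ := μ) (S.indicator fun w => ‖G w‖ₑ ^ p) u,
      ← lintegral_comp_linearMap μ T hT
        (fun y => S.indicator (fun w => ‖G w‖ₑ ^ p) (u + y)),
      ← lintegral_indicator measurableSet_ball]
    refine lintegral_mono fun x => ?_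
    by_cases hx : x ∈ ball (0 : E) 1
    · simp [hx, hTS x hx]
    · simp [hx]
  calc _ = ENNReal.ofReal (‖LinearMap.det T‖ ^ 2) * (‖G u‖ₑ ^ p * μ (ball 0 1)) := by ring
    _ ≤ ENNReal.ofReal (‖LinearMap.det T‖ ^ 2) *
        (ENNReal.ofReal ((‖LinearMap.det T‖ ^ 2)⁻¹) * ∫⁻ w in S, ‖G w‖ₑ ^ p ∂μ) := by
        exact mul_le_mul_right (h1.trans h2) _
    _ = _ := by rw [← mul_assoc, hd', one_mul]

theorem enorm_rpow_mul_sq_le_setLIntegral_ball {h : ℂ → ℂ} {p : ℝ} (hp : 0 < p) {c : ℂ} {r : ℝ}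
    (hr : 0 < r) (hh : DifferentiableOn ℂ h (ball c r)) :
    ‖h c‖ₑ ^ p * ENNReal.ofReal (r ^ 2) ≤ ∫⁻ w in ball c r, ‖h w‖ₑ ^ p := by
  have hdet : LinearMap.det ((r : ℂ) • (LinearMap.id : ℂ →ₗ[ℂ] ℂ)) = r := by
    rw [LinearMap.det_smul, LinearMap.det_id, mul_one, Module.finrank_self, pow_one]
  have h1 := enorm_rpow_mul_le_setLIntegral volume hp measurableSet_ball hh (u := c)
    (T := (r : ℂ) • (LinearMap.id : ℂ →ₗ[ℂ] ℂ)) (by rw [hdet]; exact_mod_cast hr.ne')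
    (fun x hx => by
      have hx : ‖x‖ < 1 := by simpa using hx
      rw [mem_ball_iff_norm]
      simp only [LinearMap.smul_apply, LinearMap.id_apply, smul_eq_mul, add_sub_cancel_left,
        norm_mul, Complex.norm_real, Real.norm_eq_abs, abs_of_pos hr]
      nlinarith)
  refine le_trans ?_ h1
  rw [hdet, Complex.norm_real, Real.norm_eq_abs, abs_of_pos hr, Complex.volume_ball]
  gcongr
  refine le_mul_of_one_le_right zero_le ?_
  simp only [ENNReal.ofReal_one, one_pow, one_mul]
  exact_mod_cast (by exact_mod_cast (by linarith [Real.pi_gt_three]) : (1 : ℝ) ≤ Real.pi)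

theorem enorm_deriv_rpow_le {h : ℂ → ℂ} {p : ℝ} (hp : 0 < p) {c : ℂ} {r : ℝ} (hr : 0 < r)
    (hh : DifferentiableOn ℂ h (closedBall c r)) {X : ENNReal}
    (hX : ∀ w ∈ sphere c r, ‖h w‖ₑ ^ p ≤ X) :
    ‖deriv h c‖ₑ ^ p ≤ ENNReal.ofReal (r ^ (-p)) * X := by
  rcases eq_or_ne X ⊤ with rfl | hX'
  · rw [ENNReal.mul_top]
    · exact le_top
    · simp only [ne_eq, ENNReal.ofReal_eq_zero, not_le]; positivity
  have h1 : ∀ w ∈ sphere c r, ‖h w‖ ≤ (X.toReal) ^ (1 / p) := fun w hw => by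
    have h2 := ENNReal.toReal_mono hX' (hX w hw)
    rw [← ENNReal.toReal_rpow, toReal_enorm] at h2
    rw [one_div, Real.le_rpow_inv_iff_of_pos (norm_nonneg _) ENNReal.toReal_nonneg hp]
    exact h2
  have h2 := Complex.norm_deriv_le_of_forall_mem_sphere_norm_le hr
    (hh.diffContOnCl_ball subset_rfl) h1
  have h3 : ‖deriv h c‖ ^ p ≤ r ^ (-p) * X.toReal := by
    calc ‖deriv h c‖ ^ p ≤ (X.toReal ^ (1 / p) / r) ^ p := by gcongr
      _ = r ^ (-p) * X.toReal := by
        rw [Real.div_rpow (by positivity) hr.le, ← Real.rpow_mul ENNReal.toReal_nonneg,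
          one_div_mul_cancel hp.ne', Real.rpow_one, Real.rpow_neg hr.le]
        ring
  calc ‖deriv h c‖ₑ ^ p = ENNReal.ofReal (‖deriv h c‖ ^ p) := by
        rw [← ofReal_norm, ENNReal.ofReal_rpow_of_nonneg (norm_nonneg _) hp.le]
    _ ≤ ENNReal.ofReal (r ^ (-p) * X.toReal) := ENNReal.ofReal_le_ofReal h3
    _ = _ := by rw [ENNReal.ofReal_mul (by positivity), ENNReal.ofReal_toReal hX']

/-! ### Averages over cones in logarithmic coordinates. -/

/-- The open square of half side `t` centred at the origin of the complex plane. -/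
def square (t : ℝ) : Set ℂ := {ζ | |ζ.re| < t ∧ |ζ.im| < t}

theorem lintegral_square_rpow {β : ℝ} (hβ : -1 < β) {t : ℝ} (ht : 0 < t) :
    ∫⁻ ζ : ℂ, (square t).indicator (fun ζ => ENNReal.ofReal ((t + ζ.re) ^ β)) ζ =
      ENNReal.ofReal ((2 * t) ^ (β + 2) / (β + 1)) := by
  have hx : ∫⁻ x in Ioo (-t) t, ENNReal.ofReal ((t + x) ^ β) =
      ENNReal.ofReal ((2 * t) ^ (β + 1) / (β + 1)) := by
    have hi : IntervalIntegrable (fun x => (t + x) ^ β) volume (-t) t := by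
      have := (intervalIntegral.intervalIntegrable_rpow' hβ (a := 0) (b := 2 * t)).comp_add_left t
      convert this using 1 <;> ring
    have hv : ∫ x in (-t)..t, (t + x) ^ β = (2 * t) ^ (β + 1) / (β + 1) := by
      rw [intervalIntegral.integral_comp_add_left (fun x => x ^ β) t, add_neg_cancel,
        integral_rpow (Or.inl hβ), Real.zero_rpow (by linarith), sub_zero, two_mul]
    rw [← hv, intervalIntegral.integral_of_le (by linarith), integral_Ioc_eq_integral_Ioo,
      ofReal_integral_eq_lintegral_ofReal]
    · exact hi.1.mono_set Ioo_subset_Ioc_self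
    · exact (ae_restrict_mem measurableSet_Ioo).mono fun x hx =>
        Real.rpow_nonneg (by linarith [hx.1]) _
  have hy : ∫⁻ _y in Ioo (-t) t, (1 : ENNReal) = ENNReal.ofReal (2 * t) := by
    rw [setLIntegral_one, Real.volume_Ioo]; ring_nf
  have key : ∫⁻ ζ : ℂ, (square t).indicator (fun ζ => ENNReal.ofReal ((t + ζ.re) ^ β)) ζ =
      ∫⁻ q : ℝ × ℝ, ((Ioo (-t) t).indicator (fun x => ENNReal.ofReal ((t + x) ^ β)) q.1) *
        ((Ioo (-t) t).indicator (fun _ => (1 : ENNReal)) q.2) := by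
    rw [← Complex.volume_preserving_equiv_real_prod.lintegral_comp_emb
      Complex.measurableEquivRealProd.measurableEmbedding]
    refine lintegral_congr fun ζ => ?_
    simp only [Complex.measurableEquivRealProd_apply, indicator, square, mem_ofPred_eq, abs_lt,
      mem_Ioo]
    by_cases h1 : -t < ζ.re ∧ ζ.re < t <;> by_cases h2 : -t < ζ.im ∧ ζ.im < t <;> simp [h1, h2]
  rw [key, Measure.volume_eq_prod, lintegral_prod_mul, lintegral_indicator measurableSet_Ioo,
    lintegral_indicator measurableSet_Ioo, hx, hy, ← ENNReal.ofReal_mul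
      (div_nonneg (by positivity) (by linarith))]
  · congr 1
    rw [show β + 2 = β + 1 + 1 by ring, Real.rpow_add_one (by positivity) (β + 1)]
    ring
  · exact (Measurable.indicator (by fun_prop) measurableSet_Ioo).aemeasurable
  · exact (measurable_const.indicator measurableSet_Ioo).aemeasurable

/-- The logarithmic distance `log (1 / |z|)` to the unit sphere. -/
def logDist {n : ℕ} (z : Cn n) : ℝ := -Real.log ‖z‖

/-- The open spherical shell `c < |z| < 1`. -/
def shell (n : ℕ) (c : ℝ) : Set (Cn n) := {z | c < ‖z‖ ∧ ‖z‖ < 1}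

/-- The integral of `F` over a truncated Stolz region with vertex `z` in the complex line
through `z`, in logarithmic coordinates. -/
def expAverage {n : ℕ} (F : Cn n → ENNReal) (z : Cn n) : ENNReal :=
  ∫⁻ ζ : ℂ, (square (logDist (Complex.exp ζ • z))).indicator (fun ζ => F (Complex.exp ζ • z)) ζ

variable {n : ℕ}

theorem measurableSet_shell (c : ℝ) : MeasurableSet (shell n c) :=
  (measurableSet_lt measurable_const measurable_norm).inter
    (measurableSet_lt measurable_norm measurable_const)

theorem measurable_logDist : Measurable (logDist : Cn n → ℝ) :=
  (Real.measurable_log.comp measurable_norm).neg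

theorem logDist_exp_smul {z : Cn n} (hz : z ≠ 0) (ζ : ℂ) :
    logDist (Complex.exp ζ • z) = logDist z - ζ.re := by
  unfold logDist
  rw [norm_smul, Complex.norm_exp, Real.log_mul (Real.exp_ne_zero _) (norm_ne_zero_iff.mpr hz),
    Real.log_exp]
  ring

theorem logDist_pos {z : Cn n} (h0 : 0 < ‖z‖) (h1 : ‖z‖ < 1) : 0 < logDist z :=
  neg_pos.mpr (Real.log_neg h0 h1)

theorem exp_neg_logDist {z : Cn n} (h0 : 0 < ‖z‖) : Real.exp (-logDist z) = ‖z‖ := by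
  rw [logDist, neg_neg, Real.exp_log h0]

/-- Fubini and the substitution `u = e^ζ z`. The half side in `expAverage` is measured at `u`, not
at `z`, so that for fixed `u` the admissible `ζ` fill an exact square. As `log (1/|z|) = log (1/|u|)
+ Re ζ`, the inner integral is that of `(t + Re ζ)^β` over the square; it is of order `t^(β+2)`
because `β > -1`. -/
theorem lintegral_rpow_mul_expAverage_le {β : ℝ} (hβ : -1 < β) {F : Cn n → ENNReal}
    (hF : Measurable F) (hF0 : ∀ u, u ∉ shell n (1 / 4) → F u = 0) :
    ∫⁻ z in shell n (1 / 2), ENNReal.ofReal (logDist z ^ β) * expAverage F z ≤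
      ENNReal.ofReal (16 ^ n * (2 ^ (β + 2) / (β + 1))) *
        ∫⁻ u, ENNReal.ofReal (logDist u ^ (β + 2)) * F u := by
  set S : Set (ℂ × Cn n) := {q | |q.1.re| < logDist q.2 ∧ |q.1.im| < logDist q.2} with hS
  have hl : Measurable fun q : ℂ × Cn n => logDist q.2 := measurable_logDist.comp measurable_snd
  have hre : Measurable fun q : ℂ × Cn n => q.1.re := Complex.measurable_re.comp measurable_fst
  have him : Measurable fun q : ℂ × Cn n => q.1.im := Complex.measurable_im.comp measurable_fst
  have hSm : MeasurableSet S :=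
    (measurableSet_lt hre.norm hl).inter (measurableSet_lt him.norm hl)
  set H : ℂ × Cn n → ENNReal :=
    S.indicator fun q => ENNReal.ofReal ((logDist q.2 + q.1.re) ^ β) * F q.2 with hH
  have hHm : Measurable H :=
    (((hl.add hre).pow_const β).ennreal_ofReal.mul (hF.comp measurable_snd)).indicator hSm
  have hsq : ∀ (ζ : ℂ) (u : Cn n), H (ζ, u) =
      (square (logDist u)).indicator
        (fun ζ => ENNReal.ofReal ((logDist u + ζ.re) ^ β)) ζ * F u := fun ζ u => by
    by_cases h : |ζ.re| < logDist u ∧ |ζ.im| < logDist u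
    · have h1 : (ζ, u) ∈ S := h
      have h2 : ζ ∈ square (logDist u) := h
      rw [hH, indicator_of_mem h1, indicator_of_mem h2]
    · have h1 : (ζ, u) ∉ S := h
      have h2 : ζ ∉ square (logDist u) := h
      rw [hH, indicator_of_notMem h1, indicator_of_notMem h2, zero_mul]
  have step1 : ∀ z ∈ shell n (1 / 2), ENNReal.ofReal (logDist z ^ β) * expAverage F z ≤
      ∫⁻ ζ : ℂ, H (ζ, Complex.exp ζ • z) := fun z hz => by
    have hz0 : z ≠ 0 := norm_pos_iff.mp (by linarith [hz.1])
    rw [expAverage, ← lintegral_const_mul' _ _ ENNReal.ofReal_ne_top]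
    refine lintegral_mono fun ζ => ?_
    simp only []
    rw [hsq]
    by_cases h2 : ζ ∈ square (logDist (Complex.exp ζ • z))
    · rw [indicator_of_mem h2, indicator_of_mem h2, logDist_exp_smul hz0, sub_add_cancel]
    · rw [indicator_of_notMem h2, mul_zero]
      exact zero_le
  -- On the support of the integrand `-Re ζ < log (1/|u|) < log 4`, so the Jacobian `|e^ζ|^(-2n)` is
  -- at most `16^n`.
  have step2 : ∀ (ζ : ℂ) (u : Cn n),
      ENNReal.ofReal ((‖Complex.exp ζ‖ ^ (2 * n))⁻¹) * H (ζ, u) ≤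
        ENNReal.ofReal (16 ^ n) * H (ζ, u) := fun ζ u => by
    by_cases hu : u ∈ shell n (1 / 4)
    · by_cases h : (ζ, u) ∈ S
      · gcongr
        have h1 : logDist u < Real.log 4 := by
          have := Real.log_lt_log (by norm_num) hu.1
          rw [one_div, Real.log_inv] at this
          unfold logDist; linarith
        have h2 : -ζ.re < Real.log 4 := by
          have h3 := h.1
          simp only at h3
          linarith [neg_abs_le ζ.re]
        have h3 : Real.exp (-ζ.re) ≤ 4 := by
          rw [← Real.exp_log (show (0 : ℝ) < 4 by norm_num)]
          exact Real.exp_le_exp.mpr h2.le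
        rw [Complex.norm_exp, ← inv_pow, ← Real.exp_neg, pow_mul]
        gcongr
        calc Real.exp (-ζ.re) ^ 2 ≤ 4 ^ 2 := by gcongr
          _ = 16 := by norm_num
      · rw [hH, indicator_of_notMem h, mul_zero, mul_zero]
    · rw [hsq, hF0 u hu, mul_zero, mul_zero, mul_zero]
  calc _ ≤ ∫⁻ z in shell n (1 / 2), ∫⁻ ζ : ℂ, H (ζ, Complex.exp ζ • z) :=
        setLIntegral_mono' (measurableSet_shell _) step1
    _ ≤ ∫⁻ z, ∫⁻ ζ : ℂ, H (ζ, Complex.exp ζ • z) := setLIntegral_le_lintegral _ _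
    _ = ∫⁻ ζ : ℂ, ∫⁻ z, H (ζ, Complex.exp ζ • z) := by
        refine lintegral_lintegral_swap (hHm.comp ?_).aemeasurable
        have : Continuous fun q : Cn n × ℂ => (q.2, Complex.exp q.2 • q.1) := by fun_prop
        exact this.measurable
    _ = ∫⁻ ζ : ℂ, ∫⁻ u, ENNReal.ofReal ((‖Complex.exp ζ‖ ^ (2 * n))⁻¹) * H (ζ, u) := by
        refine lintegral_congr fun ζ => ?_
        rw [lintegral_comp_complex_smul volume (Complex.exp_ne_zero ζ) fun u => H (ζ, u),
          lintegral_const_mul' _ _ ENNReal.ofReal_ne_top, finrank_euclideanSpace_fin]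
    _ ≤ ∫⁻ ζ : ℂ, ∫⁻ u, ENNReal.ofReal (16 ^ n) * H (ζ, u) :=
        lintegral_mono fun ζ => lintegral_mono fun u => step2 ζ u
    _ = ∫⁻ u, ∫⁻ ζ : ℂ, ENNReal.ofReal (16 ^ n) * H (ζ, u) :=
        lintegral_lintegral_swap (hHm.const_mul _).aemeasurable
    _ ≤ ∫⁻ u, ENNReal.ofReal (16 ^ n * (2 ^ (β + 2) / (β + 1))) *
          (ENNReal.ofReal (logDist u ^ (β + 2)) * F u) := by
        refine lintegral_mono fun u => ?_
        simp only []
        by_cases hu : u ∈ shell n (1 / 4)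
        · have ht : 0 < logDist u := logDist_pos (by linarith [hu.1]) hu.2
          rw [lintegral_const_mul' _ _ ENNReal.ofReal_ne_top]
          simp only [hsq]
          rw [lintegral_mul_const _ (Measurable.indicator (by fun_prop) ?_),
            lintegral_square_rpow hβ ht, ← mul_assoc, ← mul_assoc,
            ← ENNReal.ofReal_mul (by positivity), ← ENNReal.ofReal_mul]
          · refine le_of_eq ?_
            congr 2
            rw [Real.mul_rpow (by norm_num) ht.le]
            ring
          · have : 0 < β + 1 := by linarith
            positivity
          · exact (measurableSet_lt Complex.measurable_re.norm measurable_const).inter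
              (measurableSet_lt Complex.measurable_im.norm measurable_const)
        · simp [hsq, hF0 u hu]
    _ = _ := lintegral_const_mul' _ _ ENNReal.ofReal_ne_top

theorem rpow_le_rpow_of_comparable {x y C : ℝ} (hx : 0 < x) (hy : 0 < y) (hC : 1 ≤ C)
    (hxy : x ≤ C * y) (hyx : y ≤ C * x) (γ : ℝ) : x ^ γ ≤ C ^ |γ| * y ^ γ := by
  have hC0 : 0 < C := by linarith
  rcases le_total 0 γ with h | h
  · rw [abs_of_nonneg h, ← Real.mul_rpow hC0.le hy.le]
    gcongr
  · rw [abs_of_nonpos h, Real.rpow_neg hC0.le, ← Real.inv_rpow hC0.le,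
      ← Real.mul_rpow (by positivity) hy.le]
    refine Real.rpow_le_rpow_of_nonpos (by positivity) ?_ h
    rw [inv_mul_le_iff₀ hC0]
    exact hyx

/-- The density `log (1 / |u|) ^ γ * |g u| ^ p` on the shell `1 / 4 < |u| < 1`. -/
def shellDensity (g : Cn n → ℂ) (p γ : ℝ) : Cn n → ENNReal :=
  (shell n (1 / 4)).indicator fun u => ENNReal.ofReal (logDist u ^ γ) * ‖g u‖ₑ ^ p

theorem shell_subset_unitBall (c : ℝ) : shell n c ⊆ unitBall n := fun z hz => by
  simpa [unitBall] using hz.2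

theorem measurable_shellDensity {g : Cn n → ℂ} (hg : DifferentiableOn ℂ g (unitBall n))
    (p γ : ℝ) : Measurable (shellDensity g p γ) := by
  have h1 := measurable_indicator_enorm_rpow (measurableSet_shell (n := n) (1 / 4))
    (hg.continuousOn.mono (shell_subset_unitBall _)) p
  have h2 : Measurable fun u : Cn n => ENNReal.ofReal (logDist u ^ γ) :=
    (measurable_logDist.pow_const γ).ennreal_ofReal
  convert h2.mul h1 using 1
  ext u
  by_cases hu : u ∈ shell n (1 / 4)
  · simp only [shellDensity, Pi.mul_apply, indicator_of_mem hu]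
  · simp only [shellDensity, Pi.mul_apply, indicator_of_notMem hu, mul_zero]

/-- With `t = log (1/|e^s z|)`, the disc of radius `t/2` about `s` lies in the cone with vertex `z`,
and the logarithmic distance stays between `t/2` and `3t/2` on it. The weight is therefore a
constant up to `2^|γ|`. -/
theorem setLIntegral_ball_exp_le (g : Cn n → ℂ) (p γ : ℝ) {z : Cn n}
    (hz0 : z ≠ 0) (hz1 : ‖z‖ < 1) {s : ℝ} (hs : s ≤ 0) (ht : logDist z - s ≤ Real.log 2) :
    ∫⁻ ζ in ball (s : ℂ) ((logDist z - s) / 2), ‖g (Complex.exp ζ • z)‖ₑ ^ p ≤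
      ENNReal.ofReal (2 ^ |γ| * (logDist z - s) ^ (-γ)) * expAverage (shellDensity g p γ) z := by
  set t := logDist z - s with htdef
  have hl := logDist_pos (norm_pos_iff.mpr hz0) hz1
  have ht0 : 0 < t := by linarith
  rw [expAverage, ← lintegral_const_mul' _ _ ENNReal.ofReal_ne_top,
    ← lintegral_indicator measurableSet_ball]
  refine lintegral_mono fun ζ => ?_
  simp only []
  by_cases hζ : ζ ∈ ball (s : ℂ) (t / 2)
  · have hn : ‖ζ - s‖ < t / 2 := by simpa [dist_eq_norm] using hζ
    have hre := (Complex.abs_re_le_norm (ζ - s)).trans_lt hn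
    have him := (Complex.abs_im_le_norm (ζ - s)).trans_lt hn
    simp only [Complex.sub_re, Complex.ofReal_re, Complex.sub_im, Complex.ofReal_im, sub_zero,
      abs_lt] at hre him
    have hu := logDist_exp_smul hz0 ζ
    set u := Complex.exp ζ • z with hudef
    have hu1 : t / 2 < logDist u := by linarith
    have hu2 : logDist u < 3 / 2 * t := by linarith
    have hupos : 0 < ‖u‖ := by
      rw [hudef, norm_pos_iff]; exact smul_ne_zero (Complex.exp_ne_zero _) hz0
    -- Since `t ≤ log 2`, the bound `3t/2` is below `log 4`: points over the outer half of the ball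
    -- only see the shell `1/4 < |u| < 1`.
    have hus : u ∈ shell n (1 / 4) := by
      constructor
      · rw [← exp_neg_logDist hupos]
        have h4 : (1 : ℝ) / 4 = Real.exp (-(2 * Real.log 2)) := by
          rw [Real.exp_neg, two_mul, Real.exp_add, Real.exp_log (by norm_num)]; norm_num
        rw [h4, Real.exp_lt_exp]
        have := Real.log_pos one_lt_two
        linarith
      · rw [← exp_neg_logDist hupos, Real.exp_lt_one_iff]
        linarith
    have hsq : ζ ∈ square (logDist u) := by
      constructor <;> rw [abs_lt] <;> constructor <;> linarith
    rw [indicator_of_mem hζ, indicator_of_mem hsq, shellDensity, indicator_of_mem hus, ← mul_assoc,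
      ← ENNReal.ofReal_mul (by positivity)]
    refine le_mul_of_one_le_left zero_le ?_
    rw [ENNReal.one_le_ofReal]
    have h5 := rpow_le_rpow_of_comparable ht0 (y := logDist u) (by linarith) one_le_two
      (by linarith) (by linarith) γ
    calc (1 : ℝ) = t ^ (-γ) * t ^ γ := by rw [← Real.rpow_add ht0]; simp
      _ ≤ t ^ (-γ) * (2 ^ |γ| * logDist u ^ γ) := by gcongr
      _ = _ := by ring
  · rw [indicator_of_notMem hζ]
    exact zero_le

theorem mem_unitBall_iff {z : Cn n} : z ∈ unitBall n ↔ ‖z‖ < 1 := by simp [unitBall]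

theorem differentiableOn_comp_exp_smul {g : Cn n → ℂ} (hg : DifferentiableOn ℂ g (unitBall n))
    {z : Cn n} (hz0 : z ≠ 0) :
    DifferentiableOn ℂ (fun ζ : ℂ => g (Complex.exp ζ • z)) {ζ | ζ.re < logDist z} := by
  refine hg.comp (by fun_prop) fun ζ hζ => ?_
  have hu := logDist_exp_smul hz0 ζ
  have hupos : 0 < ‖Complex.exp ζ • z‖ :=
    norm_pos_iff.mpr (smul_ne_zero (Complex.exp_ne_zero _) hz0)
  rw [mem_unitBall_iff, ← exp_neg_logDist hupos, Real.exp_lt_one_iff]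
  have : ζ.re < logDist z := hζ
  linarith

theorem hasFDerivAt_of_mem_unitBall {g : Cn n → ℂ} (hg : DifferentiableOn ℂ g (unitBall n))
    {z : Cn n} (hz : z ∈ unitBall n) : HasFDerivAt g (fderiv ℂ g z) z :=
  (hg.differentiableAt (isOpen_ball.mem_nhds hz)).hasFDerivAt

theorem deriv_comp_exp_smul {g : Cn n → ℂ} (hg : DifferentiableOn ℂ g (unitBall n))
    {z : Cn n} (hz : z ∈ unitBall n) :
    deriv (fun ζ : ℂ => g (Complex.exp ζ • z)) 0 = radialDeriv g z := by
  have h1 : HasFDerivAt g (fderiv ℂ g z) (Complex.exp 0 • z) := by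
    rw [Complex.exp_zero, one_smul]
    exact hasFDerivAt_of_mem_unitBall hg hz
  have h2 : HasDerivAt (fun ζ : ℂ => Complex.exp ζ • z) (Complex.exp 0 • z) 0 :=
    (Complex.hasDerivAt_exp 0).smul_const z
  have h3 := (h1.comp_hasDerivAt (0 : ℂ) h2).deriv
  rw [Complex.exp_zero, one_smul] at h3
  rw [radialDeriv_eq_fderiv]
  exact h3

/-- One average, attached to `z`, controls `g` at all the points `e^s z` further in on the same
radius. The exponent `-2` is the area of the disc, and `-γ` removes the weight. -/
theorem enorm_rpow_le_expAverage {g : Cn n → ℂ} (hg : DifferentiableOn ℂ g (unitBall n)) {p : ℝ}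
    (hp : 0 < p) (γ : ℝ) {z : Cn n} (hz0 : z ≠ 0) (hz1 : ‖z‖ < 1) {s : ℝ} (hs : s ≤ 0)
    (ht : logDist z - s ≤ Real.log 2) :
    ‖g (Real.exp s • z)‖ₑ ^ p ≤ ENNReal.ofReal (4 * 2 ^ |γ| * (logDist z - s) ^ (-2 - γ)) *
      expAverage (shellDensity g p γ) z := by
  have hl := logDist_pos (norm_pos_iff.mpr hz0) hz1
  set t := logDist z - s with htdef
  have ht0 : 0 < t := by linarith
  have h1 := enorm_rpow_mul_sq_le_setLIntegral_ball hp (c := (s : ℂ)) (r := t / 2) (by positivity)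
    ((differentiableOn_comp_exp_smul hg hz0).mono fun ζ hζ => by
      have hn : ‖ζ - s‖ < t / 2 := by simpa [dist_eq_norm] using hζ
      have hre := (Complex.re_le_norm (ζ - s)).trans_lt hn
      simp only [Complex.sub_re, Complex.ofReal_re] at hre
      show ζ.re < logDist z
      linarith)
  have h2 := h1.trans (setLIntegral_ball_exp_le g p γ hz0 hz1 hs ht)
  have h3 : Complex.exp (s : ℂ) • z = Real.exp s • z := by
    rw [← Complex.ofReal_exp, Complex.coe_smul]
  simp only [h3] at h2
  have h4 : ENNReal.ofReal ((t / 2) ^ 2) * ENNReal.ofReal (((t / 2) ^ 2)⁻¹) = 1 := by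
    rw [← ENNReal.ofReal_mul (by positivity), mul_inv_cancel₀ (by positivity), ENNReal.ofReal_one]
  calc ‖g (Real.exp s • z)‖ₑ ^ p
      = ‖g (Real.exp s • z)‖ₑ ^ p * ENNReal.ofReal ((t / 2) ^ 2) *
          ENNReal.ofReal (((t / 2) ^ 2)⁻¹) := by rw [mul_assoc, h4, mul_one]
    _ ≤ ENNReal.ofReal (2 ^ |γ| * t ^ (-γ)) * expAverage (shellDensity g p γ) z *
          ENNReal.ofReal (((t / 2) ^ 2)⁻¹) := mul_le_mul_left h2 _
    _ = ENNReal.ofReal (((t / 2) ^ 2)⁻¹ * (2 ^ |γ| * t ^ (-γ))) *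
          expAverage (shellDensity g p γ) z := by
        rw [ENNReal.ofReal_mul (p := ((t / 2) ^ 2)⁻¹) (by positivity), ← mul_rotate]
    _ = _ := by
        congr 2
        rw [sub_eq_add_neg, Real.rpow_add ht0, Real.rpow_neg ht0.le 2, Real.rpow_two]
        field_simp
        norm_num

theorem logDist_le_log_two {z : Cn n} (hz : 1 / 2 ≤ ‖z‖) : logDist z ≤ Real.log 2 := by
  have := Real.log_le_log (by norm_num) hz
  rw [one_div, Real.log_inv] at this
  unfold logDist; linarith

/-- Cauchy's estimate on the circle of radius `t/4`, with the mean value property on discs of radius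
`t/4` about its points; all these lie in the disc of radius `t/2`. The weight exponent `-2` makes
the average an unweighted area mean. -/
theorem enorm_radialDeriv_rpow_le_expAverage {g : Cn n → ℂ}
    (hg : DifferentiableOn ℂ g (unitBall n)) {p : ℝ} (hp : 0 < p) {z : Cn n}
    (hz : z ∈ shell n (1 / 2)) :
    ‖radialDeriv g z‖ₑ ^ p ≤ ENNReal.ofReal (64 * 4 ^ p * logDist z ^ (-p)) *
      expAverage (shellDensity g p (-2)) z := by
  have hzpos : 0 < ‖z‖ := by linarith [hz.1]
  have hz0 : z ≠ 0 := norm_pos_iff.mp hzpos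
  have hl := logDist_pos hzpos hz.2
  set t := logDist z with htdef
  set h : ℂ → ℂ := fun ζ => g (Complex.exp ζ • z) with hh
  have hd := differentiableOn_comp_exp_smul hg hz0
  have hball := setLIntegral_ball_exp_le g p (-2) hz0 hz.2 le_rfl
    (by rw [sub_zero]; exact logDist_le_log_two hz.1.le)
  rw [sub_zero, ← htdef, Complex.ofReal_zero] at hball
  have hsup : ∀ w ∈ sphere (0 : ℂ) (t / 4), ‖h w‖ₑ ^ p ≤
      ENNReal.ofReal (((t / 4) ^ 2)⁻¹ * (2 ^ |(-2 : ℝ)| * t ^ (-(-2 : ℝ)))) *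
        expAverage (shellDensity g p (-2)) z := fun w hw => by
    have hw' : ‖w‖ = t / 4 := by simpa using hw
    have hsub : ball w (t / 4) ⊆ ball 0 (t / 2) := by
      refine ball_subset_ball' ?_
      rw [dist_zero_right, hw']; linarith
    have h1 := enorm_rpow_mul_sq_le_setLIntegral_ball hp (c := w) (r := t / 4) (by positivity)
      (hd.mono fun ζ hζ => by
        have h2 : ‖ζ‖ < t / 2 := by simpa using hsub hζ
        have h3 := Complex.re_le_norm ζ
        show ζ.re < t
        linarith)
    have h2 := (h1.trans (lintegral_mono_set hsub)).trans hball
    have h4 : ENNReal.ofReal ((t / 4) ^ 2) * ENNReal.ofReal (((t / 4) ^ 2)⁻¹) = 1 := by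
      rw [← ENNReal.ofReal_mul (by positivity), mul_inv_cancel₀ (by positivity),
        ENNReal.ofReal_one]
    calc ‖h w‖ₑ ^ p = ‖h w‖ₑ ^ p * ENNReal.ofReal ((t / 4) ^ 2) *
          ENNReal.ofReal (((t / 4) ^ 2)⁻¹) := by rw [mul_assoc, h4, mul_one]
      _ ≤ _ := mul_le_mul_left h2 _
      _ = _ := by rw [ENNReal.ofReal_mul (p := ((t / 4) ^ 2)⁻¹) (by positivity)]; ring
  have h1 := enorm_deriv_rpow_le hp (by positivity) (hd.mono fun ζ hζ => by
        have h2 : ‖ζ‖ ≤ t / 4 := by simpa using hζ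
        have h3 := Complex.re_le_norm ζ
        show ζ.re < t
        linarith) hsup
  rw [deriv_comp_exp_smul hg (shell_subset_unitBall _ hz)] at h1
  refine h1.trans_eq ?_
  rw [← mul_assoc, ← ENNReal.ofReal_mul (by positivity)]
  congr 2
  rw [Real.div_rpow hl.le (by norm_num), neg_neg, abs_neg, abs_two, Real.rpow_two, Real.rpow_two,
    Real.rpow_neg (by norm_num : (0 : ℝ) ≤ 4)]
  field_simp
  norm_num

theorem lintegral_shell_radialDeriv_le {g : Cn n → ℂ} (hg : DifferentiableOn ℂ g (unitBall n))
    {p : ℝ} (hp : 0 < p) {b : ℝ} (hb : -1 < b) :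
    ∃ C : ℝ, ∫⁻ z in shell n (1 / 2),
        ENNReal.ofReal (logDist z ^ (b + p)) * ‖radialDeriv g z‖ₑ ^ p ≤
      ENNReal.ofReal C * ∫⁻ u in shell n (1 / 4),
        ENNReal.ofReal (logDist u ^ b) * ‖g u‖ₑ ^ p := by
  refine ⟨64 * 4 ^ p * (16 ^ n * (2 ^ (b + 2) / (b + 1))), ?_⟩
  calc _ ≤ ∫⁻ z in shell n (1 / 2), ENNReal.ofReal (64 * 4 ^ p) *
        (ENNReal.ofReal (logDist z ^ b) * expAverage (shellDensity g p (-2)) z) := by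
        refine setLIntegral_mono' (measurableSet_shell _) fun z hz => ?_
        have hl := logDist_pos (by linarith [hz.1]) hz.2
        refine (mul_le_mul_right (enorm_radialDeriv_rpow_le_expAverage hg hp hz) _).trans_eq ?_
        rw [← mul_assoc, ← mul_assoc, ← ENNReal.ofReal_mul (by positivity),
          ← ENNReal.ofReal_mul (by positivity)]
        congr 2
        rw [Real.rpow_add hl, Real.rpow_neg hl.le]
        field_simp
    _ = ENNReal.ofReal (64 * 4 ^ p) * ∫⁻ z in shell n (1 / 2),
        ENNReal.ofReal (logDist z ^ b) * expAverage (shellDensity g p (-2)) z :=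
        lintegral_const_mul' _ _ ENNReal.ofReal_ne_top
    _ ≤ ENNReal.ofReal (64 * 4 ^ p) * _ :=
        mul_le_mul_right (lintegral_rpow_mul_expAverage_le hb (measurable_shellDensity hg p (-2))
          fun u hu => indicator_of_notMem hu _) _
    _ = _ := by
        rw [← mul_assoc, ← ENNReal.ofReal_mul (by positivity),
          ← lintegral_indicator (measurableSet_shell _)]
        congr 1
        refine lintegral_congr fun u => ?_
        by_cases hu : u ∈ shell n (1 / 4)
        · have hl := logDist_pos (by linarith [hu.1]) hu.2
          rw [shellDensity, indicator_of_mem hu, indicator_of_mem hu, ← mul_assoc,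
            ← ENNReal.ofReal_mul (by positivity), ← Real.rpow_add hl]
          simp
        · rw [shellDensity, indicator_of_notMem hu, indicator_of_notMem hu, mul_zero]

theorem one_sub_norm_le_logDist {z : Cn n} (hz0 : 0 < ‖z‖) : 1 - ‖z‖ ≤ logDist z := by
  have := Real.log_le_sub_one_of_pos hz0
  unfold logDist; linarith

theorem logDist_le_div {z : Cn n} (hz0 : 0 < ‖z‖) : logDist z ≤ (1 - ‖z‖) / ‖z‖ := by
  have := Real.log_le_sub_one_of_pos (inv_pos.mpr hz0)
  rw [Real.log_inv] at this
  unfold logDist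
  rw [sub_div, div_self hz0.ne', one_div]; exact this

theorem hasDerivAt_comp_real_smul {g : Cn n → ℂ} (hg : DifferentiableOn ℂ g (unitBall n))
    {e : Cn n} {ρ : ℝ} (hρ : ρ ≠ 0) (h : ρ • e ∈ unitBall n) :
    HasDerivAt (fun ρ : ℝ => g (ρ • e)) ((ρ : ℂ)⁻¹ * radialDeriv g (ρ • e)) ρ := by
  have h1 : HasFDerivAt g ((fderiv ℂ g (ρ • e)).restrictScalars ℝ) (ρ • e) :=
    (hasFDerivAt_of_mem_unitBall hg h).restrictScalars ℝ
  have h2 : HasDerivAt (fun ρ : ℝ => ρ • e) ((1 : ℝ) • e) ρ := (hasDerivAt_id ρ).smul_const e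
  have h3 := h1.comp_hasDerivAt ρ h2
  refine HasDerivAt.congr_deriv h3 ?_
  rw [radialDeriv_eq_fderiv, one_smul, ← Complex.coe_smul, map_smul, smul_eq_mul,
    inv_mul_cancel_left₀ (by exact_mod_cast hρ)]
  simp

theorem add_rpow_le_two_rpow_mul {a b p : ℝ} (ha : 0 ≤ a) (hb : 0 ≤ b) (hp : 0 ≤ p) :
    (a + b) ^ p ≤ 2 ^ p * (a ^ p + b ^ p) := by
  rcases le_total a b with h | h
  · calc (a + b) ^ p ≤ (2 * b) ^ p := by gcongr; linarith
      _ = 2 ^ p * b ^ p := Real.mul_rpow (by norm_num) hb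
      _ ≤ _ := by gcongr; have := Real.rpow_nonneg ha p; linarith
  · calc (a + b) ^ p ≤ (2 * a) ^ p := by gcongr; linarith
      _ = 2 ^ p * a ^ p := Real.mul_rpow (by norm_num) ha
      _ ≤ _ := by gcongr; have := Real.rpow_nonneg hb p; linarith

theorem enorm_rpow_eq_ofReal {p : ℝ} (hp : 0 ≤ p) (y : ℂ) :
    ‖y‖ₑ ^ p = ENNReal.ofReal (‖y‖ ^ p) := by
  rw [← ofReal_norm, ENNReal.ofReal_rpow_of_nonneg (norm_nonneg _) hp]

/-- The average `x` at `z` bounds `R g` on the whole radius: `|R g(ρe)|^p` is at most a constant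
times `x (1-ρ)^(-p-ε)`. Integrating the `p`-th root from `1/2` to `|z|` gives a multiple of
`(1-|z|)^(-ε/p)`; without `ε` there would be a logarithm. This takes the place of Hardy's inequality
and works for every `p > 0`. -/
theorem enorm_rpow_le_add_expAverage_radialDeriv {p ε : ℝ} (hp : 0 < p) (hε : 0 < ε) :
    ∃ C : ℝ, 0 < C ∧ ∀ g : Cn n → ℂ, DifferentiableOn ℂ g (unitBall n) → ∀ M : ℝ, 0 ≤ M →
      (∀ w, ‖w‖ = 1 / 2 → ‖g w‖ ≤ M) → ∀ z ∈ shell n (1 / 2),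
      ‖g z‖ₑ ^ p ≤ ENNReal.ofReal (2 ^ p * M ^ p) + ENNReal.ofReal (C * logDist z ^ (-ε)) *
        expAverage (shellDensity (radialDeriv g) p (p - 2 + ε)) z := by
  set A : ℝ := 4 * 2 ^ |p - 2 + ε| with hA
  have hA0 : 0 < A := by positivity
  set η := ε / p with hη
  have hη0 : 0 < η := by positivity
  refine ⟨2 ^ p * ((2 / η) ^ p * A * 2 ^ ε), by positivity, fun g hg M hM0 hM z hz => ?_⟩
  have hr : 0 < ‖z‖ := by linarith [hz.1]
  have hz0 : z ≠ 0 := norm_pos_iff.mp hr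
  have hl := logDist_pos hr hz.2
  have hG := differentiableOn_radialDeriv hg
  set X := expAverage (shellDensity (radialDeriv g) p (p - 2 + ε)) z with hX
  rcases eq_or_ne X ⊤ with hXt | hXt
  · rw [hXt, ENNReal.mul_top]
    · simp
    · simp only [ne_eq, ENNReal.ofReal_eq_zero, not_le]; positivity
  set x := X.toReal with hx
  have hx0 : 0 ≤ x := ENNReal.toReal_nonneg
  have hXx : X = ENNReal.ofReal x := (ENNReal.ofReal_toReal hXt).symm
  set D := (A * x) ^ (1 / p) with hD
  have hD0 : 0 ≤ D := by positivity
  have hDp : D ^ p = A * x := by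
    rw [hD, ← Real.rpow_mul (by positivity), one_div_mul_cancel hp.ne', Real.rpow_one]
  set e := ‖z‖⁻¹ • z with he
  have hen : ‖e‖ = 1 := by
    rw [he, norm_smul, norm_inv, norm_norm, inv_mul_cancel₀ hr.ne']
  have hze : ‖z‖ • e = z := by rw [he, smul_smul, mul_inv_cancel₀ hr.ne', one_smul]
  have hmem : ∀ ρ ∈ Icc (1 / 2) ‖z‖, ρ • e ∈ unitBall n := fun ρ hρ => by
    rw [mem_unitBall_iff, norm_smul, hen, mul_one, Real.norm_of_nonneg (by linarith [hρ.1])]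
    exact hρ.2.trans_lt hz.2
  have hbound : ∀ ρ ∈ Icc (1 / 2) ‖z‖, ‖radialDeriv g (ρ • e)‖ ≤ D * (1 - ρ) ^ (-η - 1) := by
    intro ρ hρ
    have hρ0 : 0 < ρ := by linarith [hρ.1]
    have hρ1 : 0 < 1 - ρ := by linarith [hρ.2, hz.2]
    have hexp : Real.exp (Real.log (ρ / ‖z‖)) • z = ρ • e := by
      rw [Real.exp_log (by positivity), he, smul_smul, div_eq_mul_inv]
    have ht : logDist z - Real.log (ρ / ‖z‖) = -Real.log ρ := by
      rw [Real.log_div hρ0.ne' hr.ne', logDist]; ring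
    have hlog2 : -Real.log ρ ≤ Real.log 2 := by
      have := Real.log_le_log (by norm_num) hρ.1
      rw [one_div, Real.log_inv] at this; linarith
    have h1 := enorm_rpow_le_expAverage hG hp (p - 2 + ε) hz0 hz.2 (s := Real.log (ρ / ‖z‖))
      (Real.log_nonpos (by positivity) ((div_le_one hr).mpr hρ.2)) (by rw [ht]; exact hlog2)
    have hlρ : 1 - ρ ≤ -Real.log ρ := by linarith [Real.log_le_sub_one_of_pos hρ0]
    have hlρ0 : 0 < -Real.log ρ := by linarith
    rw [hexp, ht, ← hX, hXx, enorm_rpow_eq_ofReal hp.le, ← ENNReal.ofReal_mul (by positivity),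
      ENNReal.ofReal_le_ofReal_iff (by positivity)] at h1
    have h2 : ‖radialDeriv g (ρ • e)‖ ^ p ≤ (D * (1 - ρ) ^ (-η - 1)) ^ p := by
      rw [Real.mul_rpow hD0 (by positivity), hDp, ← Real.rpow_mul hρ1.le]
      have h3 : (-η - 1) * p = -2 - (p - 2 + ε) := by rw [hη]; field_simp; ring
      rw [h3]
      calc _ ≤ A * (-Real.log ρ) ^ (-2 - (p - 2 + ε)) * x := h1
        _ ≤ A * (1 - ρ) ^ (-2 - (p - 2 + ε)) * x := by
          have := Real.rpow_le_rpow_of_nonpos hρ1 hlρ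
            (show -2 - (p - 2 + ε) ≤ 0 by linarith)
          gcongr
        _ = _ := by ring
    exact (Real.rpow_le_rpow_iff (norm_nonneg _) (by positivity) hp).mp h2
  -- The majorant `B` is the antiderivative of the bound on the radial derivative that equals `M`
  -- plus a positive term at `1/2`; the factor `2` bounds `ρ⁻¹`.
  have hmvt := image_norm_le_of_norm_deriv_right_le_deriv_boundary' (a := 1 / 2) (b := ‖z‖)
    (f := fun ρ : ℝ => g (ρ • e)) (f' := fun ρ => (ρ : ℂ)⁻¹ * radialDeriv g (ρ • e))
    (B := fun ρ => M + 2 * D / η * (1 - ρ) ^ (-η))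
    (B' := fun ρ => 2 * D * (1 - ρ) ^ (-η - 1))
    (fun ρ hρ => (hasDerivAt_comp_real_smul hg (by linarith [hρ.1])
      (hmem ρ hρ)).continuousAt.continuousWithinAt)
    (fun ρ hρ => (hasDerivAt_comp_real_smul hg (by linarith [hρ.1])
      (hmem ρ (Ico_subset_Icc_self hρ))).hasDerivWithinAt)
    (by
      have h1 := hM ((1 / 2 : ℝ) • e) (by rw [norm_smul, hen]; norm_num)
      have h2 : 0 ≤ 2 * D / η * (1 - 1 / 2 : ℝ) ^ (-η) := by positivity
      linarith)
    (by
      refine ContinuousOn.add continuousOn_const (ContinuousOn.mul continuousOn_const ?_)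
      refine ContinuousOn.rpow_const (by fun_prop) fun ρ hρ => Or.inl ?_
      have := hz.2.trans_le' hρ.2
      linarith)
    (fun ρ hρ => by
      have hρ1 : 0 < 1 - ρ := by linarith [hρ.2, hz.2]
      have h1 : HasDerivAt (fun ρ : ℝ => 1 - ρ) (-1) ρ := by
        simpa using (hasDerivAt_id ρ).const_sub 1
      have h2 := ((h1.rpow_const (p := -η) (Or.inl hρ1.ne')).const_mul (2 * D / η)).const_add M
      refine (h2.congr_deriv ?_).hasDerivWithinAt
      field_simp)
    (fun ρ hρ => by
      have hρ0 : 0 < ρ := by linarith [hρ.1]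
      have hρ1 : 0 < 1 - ρ := by linarith [hρ.2, hz.2]
      rw [norm_mul, norm_inv, Complex.norm_real, Real.norm_of_nonneg hρ0.le, mul_assoc]
      have h1 : ρ⁻¹ ≤ 2 := by
        rw [inv_le_comm₀ hρ0 (by norm_num)]; linarith [hρ.1]
      exact mul_le_mul h1 (hbound ρ (Ico_subset_Icc_self hρ)) (norm_nonneg _) (by norm_num))
    (right_mem_Icc.mpr hz.1.le)
  simp only [hze] at hmvt
  have h1r : 0 < 1 - ‖z‖ := by linarith [hz.2]
  have hfin : ‖g z‖ ^ p ≤ 2 ^ p * M ^ p +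
      2 ^ p * ((2 / η) ^ p * A * 2 ^ ε) * logDist z ^ (-ε) * x := by
    have h2 : (1 - ‖z‖) ^ (-ε) ≤ 2 ^ ε * logDist z ^ (-ε) := by
      have h3 : logDist z / 2 ≤ 1 - ‖z‖ := by
        have h4 := logDist_le_div hr
        rw [le_div_iff₀ hr] at h4
        nlinarith [hz.1]
      calc (1 - ‖z‖) ^ (-ε) ≤ (logDist z / 2) ^ (-ε) :=
            Real.rpow_le_rpow_of_nonpos (by positivity) h3 (by linarith)
        _ = _ := by
            rw [Real.div_rpow hl.le (by norm_num), Real.rpow_neg (by norm_num : (0 : ℝ) ≤ 2)]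
            field_simp
    calc ‖g z‖ ^ p ≤ (M + 2 * D / η * (1 - ‖z‖) ^ (-η)) ^ p := by gcongr
      _ ≤ 2 ^ p * (M ^ p + (2 * D / η * (1 - ‖z‖) ^ (-η)) ^ p) :=
          add_rpow_le_two_rpow_mul hM0 (by positivity) hp.le
      _ = 2 ^ p * M ^ p + 2 ^ p * ((2 / η) ^ p * A) * (1 - ‖z‖) ^ (-ε) * x := by
          rw [show 2 * D / η = 2 / η * D by ring, Real.mul_rpow (by positivity) (by positivity),
            Real.mul_rpow (by positivity) hD0, hDp, ← Real.rpow_mul h1r.le,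
            show -η * p = -ε by rw [hη]; field_simp]
          ring
      _ ≤ 2 ^ p * M ^ p + 2 ^ p * ((2 / η) ^ p * A) * (2 ^ ε * logDist z ^ (-ε)) * x := by
          gcongr
      _ = _ := by ring
  rw [enorm_rpow_eq_ofReal hp.le, hXx, ← ENNReal.ofReal_mul (by positivity),
    ← ENNReal.ofReal_add (by positivity) (by positivity)]
  exact ENNReal.ofReal_le_ofReal hfin

theorem lintegral_unitBall_one_sub_norm_rpow_lt_top {b : ℝ} (hb : -1 < b) :
    ∫⁻ z in unitBall n, ENNReal.ofReal ((1 - ‖z‖) ^ b) < ⊤ := by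
  rcases Nat.eq_zero_or_pos n with rfl | hn
  · have h : ∀ z : Cn 0, ‖z‖ = 0 := fun z => by rw [Subsingleton.elim z 0, norm_zero]
    simp only [h, sub_zero, Real.one_rpow, ENNReal.ofReal_one, setLIntegral_one]
    exact measure_ball_lt_top
  have : Nonempty (Fin n) := ⟨⟨0, hn⟩⟩
  have h1 : IntegrableOn (fun z : Cn n => (1 - ‖z‖) ^ b) (ball 0 1) volume := by
    rw [integrableOn_fun_norm_addHaar volume (f := fun y => (1 - y) ^ b)]
    have h2 : IntervalIntegrable (fun y : ℝ => (1 - y) ^ b) volume 0 1 := by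
      have := (intervalIntegral.intervalIntegrable_rpow' hb (a := 0) (b := 1)).comp_sub_left 1
      simpa using this.symm
    have h3 : IntervalIntegrable (fun y : ℝ => y ^ (Module.finrank ℝ (Cn n) - 1) • (1 - y) ^ b)
        volume 0 1 := h2.continuousOn_mul (by fun_prop)
    exact h3.1.mono_set Ioo_subset_Ioc_self
  have h4 := h1.2
  rw [hasFiniteIntegral_iff_ofReal] at h4
  · exact h4
  · refine (ae_restrict_mem measurableSet_ball).mono fun z hz => ?_
    have : ‖z‖ < 1 := by simpa using hz
    exact Real.rpow_nonneg (by linarith) _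

/-! ### Weighted integrals over the ball and equivalence of `g` with `R g`. -/

/-- The integral of `(1 - |z|²) ^ b * |g z| ^ p` over the unit ball. -/
def ballIntegral (b p : ℝ) (g : Cn n → ℂ) : ENNReal :=
  ∫⁻ z in unitBall n, ENNReal.ofReal ((1 - ‖z‖ ^ 2) ^ b) * ‖g z‖ₑ ^ p

theorem logDist_comparable_one_sub_sq {z : Cn n} (hz : z ∈ shell n (1 / 4)) :
    logDist z ≤ 4 * (1 - ‖z‖ ^ 2) ∧ 1 - ‖z‖ ^ 2 ≤ 4 * logDist z := by
  have hr : 0 < ‖z‖ := by linarith [hz.1]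
  have h1 := one_sub_norm_le_logDist hr
  have h2 := logDist_le_div hr
  rw [le_div_iff₀ hr] at h2
  have h3 := hz.1
  have h4 := hz.2
  have h5 := logDist_pos hr hz.2
  constructor <;> nlinarith

theorem one_sub_norm_sq_pos {z : Cn n} (hz : ‖z‖ < 1) : 0 < 1 - ‖z‖ ^ 2 := by
  nlinarith [norm_nonneg z]

theorem ofReal_rpow_le_of_comparable {x y : ℝ} (hx : 0 < x) (hy : 0 < y) {C : ℝ} (hC : 1 ≤ C)
    (hxy : x ≤ C * y) (hyx : y ≤ C * x) (b : ℝ) :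
    ENNReal.ofReal (x ^ b) ≤ ENNReal.ofReal (C ^ |b|) * ENNReal.ofReal (y ^ b) := by
  rw [← ENNReal.ofReal_mul (by positivity)]
  exact ENNReal.ofReal_le_ofReal (rpow_le_rpow_of_comparable hx hy hC hxy hyx b)

theorem setLIntegral_shell_le_ballIntegral (b p : ℝ) (g : Cn n → ℂ) :
    ∫⁻ u in shell n (1 / 4), ENNReal.ofReal (logDist u ^ b) * ‖g u‖ₑ ^ p ≤
      ENNReal.ofReal (4 ^ |b|) * ballIntegral b p g := by
  rw [ballIntegral, ← lintegral_const_mul' _ _ ENNReal.ofReal_ne_top]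
  refine (setLIntegral_mono' (measurableSet_shell _) fun u hu => ?_).trans
    (lintegral_mono_set (shell_subset_unitBall _))
  have hc := logDist_comparable_one_sub_sq hu
  rw [← mul_assoc]
  exact mul_le_mul_left (ofReal_rpow_le_of_comparable (logDist_pos (by linarith [hu.1]) hu.2)
    (one_sub_norm_sq_pos hu.2) (by norm_num) hc.1 hc.2 b) _

theorem ballIntegral_lt_top_of_shell {b p : ℝ} (hp : 0 < p) {g : Cn n → ℂ}
    (hg : DifferentiableOn ℂ g (unitBall n))
    (h : ∫⁻ u in shell n (1 / 2), ENNReal.ofReal (logDist u ^ b) * ‖g u‖ₑ ^ p < ⊤) :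
    ballIntegral b p g < ⊤ := by
  have hsub : unitBall n ⊆ closedBall 0 (1 / 2) ∪ shell n (1 / 2) := fun z hz => by
    rcases le_or_gt ‖z‖ (1 / 2) with h | h
    · exact Or.inl (by simpa using h)
    · exact Or.inr ⟨h, mem_unitBall_iff.mp hz⟩
  refine (lintegral_mono_set hsub).trans_lt ((lintegral_union_le _ _ _).trans_lt
    (ENNReal.add_lt_top.mpr ⟨?_, ?_⟩))
  · have hc : ContinuousOn (fun z : Cn n => (1 - ‖z‖ ^ 2) ^ b * ‖g z‖ ^ p)
        (closedBall 0 (1 / 2)) := by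
      refine ContinuousOn.mul (ContinuousOn.rpow_const (by fun_prop) fun z hz => Or.inl ?_)
        (ContinuousOn.rpow_const (hg.continuousOn.norm.mono fun z hz => ?_) fun z hz => Or.inr hp.le)
      · have : ‖z‖ ≤ 1 / 2 := by simpa using hz
        nlinarith [norm_nonneg z]
      · have : ‖z‖ ≤ 1 / 2 := by simpa using hz
        rw [mem_unitBall_iff]; linarith
    obtain ⟨M, hM⟩ := (isCompact_closedBall (0 : Cn n) (1 / 2)).exists_bound_of_continuousOn hc
    refine (setLIntegral_mono' measurableSet_closedBall (g := fun _ => ENNReal.ofReal M)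
      fun z hz => ?_).trans_lt ?_
    · rw [enorm_rpow_eq_ofReal hp.le, ← ENNReal.ofReal_mul]
      · exact ENNReal.ofReal_le_ofReal ((le_abs_self _).trans (hM z hz))
      · have : ‖z‖ ≤ 1 / 2 := by simpa using hz
        exact Real.rpow_nonneg (by nlinarith [norm_nonneg z]) _
    · rw [setLIntegral_const]
      exact ENNReal.mul_lt_top ENNReal.ofReal_lt_top measure_closedBall_lt_top
  · refine lt_of_le_of_lt ?_ (ENNReal.mul_lt_top (a := ENNReal.ofReal (4 ^ |b|))
      ENNReal.ofReal_lt_top h)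
    rw [← lintegral_const_mul' _ _ ENNReal.ofReal_ne_top]
    refine setLIntegral_mono' (measurableSet_shell _) fun u hu => ?_
    have hc := logDist_comparable_one_sub_sq (z := u) ⟨by linarith [hu.1], hu.2⟩
    rw [← mul_assoc]
    exact mul_le_mul_left (ofReal_rpow_le_of_comparable (one_sub_norm_sq_pos hu.2)
      (logDist_pos (by linarith [hu.1]) hu.2) (by norm_num) hc.2 hc.1 b) _

theorem setLIntegral_shell_logDist_rpow_lt_top {b : ℝ} (hb : -1 < b) :
    ∫⁻ u in shell n (1 / 2), ENNReal.ofReal (logDist u ^ b) < ⊤ := by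
  have h := lintegral_unitBall_one_sub_norm_rpow_lt_top (n := n) hb
  refine lt_of_le_of_lt ?_ (ENNReal.mul_lt_top (a := ENNReal.ofReal (2 ^ |b|))
    ENNReal.ofReal_lt_top h)
  rw [← lintegral_const_mul' _ _ ENNReal.ofReal_ne_top]
  refine (setLIntegral_mono' (measurableSet_shell _) fun u hu => ?_).trans
    (lintegral_mono_set (shell_subset_unitBall _))
  have hr : 0 < ‖u‖ := by linarith [hu.1]
  have h1 := one_sub_norm_le_logDist hr
  have h2 := logDist_le_div hr
  rw [le_div_iff₀ hr] at h2
  have hl := logDist_pos hr hu.2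
  exact ofReal_rpow_le_of_comparable hl (by linarith [hu.2]) one_le_two
    (by nlinarith [hu.1]) (by linarith) b

theorem setLIntegral_shell_lt_top_of_radialDeriv {g : Cn n → ℂ}
    (hg : DifferentiableOn ℂ g (unitBall n)) {p : ℝ} (hp : 0 < p) {b : ℝ} (hb : -1 < b)
    (h : ∫⁻ u in shell n (1 / 4),
      ENNReal.ofReal (logDist u ^ (b + p)) * ‖radialDeriv g u‖ₑ ^ p < ⊤) :
    ∫⁻ z in shell n (1 / 2), ENNReal.ofReal (logDist z ^ b) * ‖g z‖ₑ ^ p < ⊤ := by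
  -- Half of the available room: `b - ε` is still greater than `-1`. The exponents then balance, `(b
  -- - ε) + 2 + (p - 2 + ε) = b + p`.
  set ε := (b + 1) / 2 with hε
  have hε0 : 0 < ε := by rw [hε]; linarith
  have hβ : -1 < b - ε := by rw [hε]; linarith
  obtain ⟨C, hC, hpt⟩ := enorm_rpow_le_add_expAverage_radialDeriv (n := n) hp hε0
  obtain ⟨M, hM⟩ : ∃ M, ∀ w ∈ closedBall (0 : Cn n) (1 / 2), ‖g w‖ ≤ M :=
    (isCompact_closedBall _ _).exists_bound_of_continuousOn
      (hg.continuousOn.mono (closedBall_subset_ball (by norm_num)))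
  have hM0 : 0 ≤ M := (norm_nonneg _).trans (hM 0 (by simp))
  have hpt' := hpt g hg M hM0 fun w hw => hM w (by simp [hw])
  set X := expAverage (shellDensity (radialDeriv g) p (p - 2 + ε)) with hX
  have hbnd : ∀ z ∈ shell n (1 / 2), ENNReal.ofReal (logDist z ^ b) * ‖g z‖ₑ ^ p ≤
      ENNReal.ofReal (2 ^ p * M ^ p) * ENNReal.ofReal (logDist z ^ b) +
        ENNReal.ofReal C * (ENNReal.ofReal (logDist z ^ (b - ε)) * X z) := fun z hz => by
    have hl := logDist_pos (by linarith [hz.1]) hz.2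
    refine (mul_le_mul_right (hpt' z hz) _).trans_eq ?_
    rw [mul_add, mul_comm, ← mul_assoc, ← mul_assoc, ← ENNReal.ofReal_mul (p := logDist z ^ b)
      (by positivity), ← ENNReal.ofReal_mul (p := C) hC.le]
    congr 3
    rw [sub_eq_add_neg, Real.rpow_add hl]
    ring
  refine (setLIntegral_mono' (measurableSet_shell _) hbnd).trans_lt ?_
  rw [lintegral_add_left (by
    exact ((measurable_logDist.pow_const b).ennreal_ofReal.const_mul _)),
    lintegral_const_mul' _ _ ENNReal.ofReal_ne_top, lintegral_const_mul' _ _ ENNReal.ofReal_ne_top]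
  refine ENNReal.add_lt_top.mpr ⟨ENNReal.mul_lt_top ENNReal.ofReal_lt_top
    (setLIntegral_shell_logDist_rpow_lt_top hb), ENNReal.mul_lt_top ENNReal.ofReal_lt_top ?_⟩
  refine (lintegral_rpow_mul_expAverage_le hβ
    (measurable_shellDensity (differentiableOn_radialDeriv hg) p (p - 2 + ε))
    fun u hu => indicator_of_notMem hu _).trans_lt (ENNReal.mul_lt_top ENNReal.ofReal_lt_top ?_)
  refine lt_of_eq_of_lt ?_ h
  rw [← lintegral_indicator (measurableSet_shell _)]
  refine lintegral_congr fun u => ?_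
  by_cases hu : u ∈ shell n (1 / 4)
  · have hl := logDist_pos (by linarith [hu.1]) hu.2
    rw [shellDensity, indicator_of_mem hu, indicator_of_mem hu, ← mul_assoc,
      ← ENNReal.ofReal_mul (by positivity), ← Real.rpow_add hl]
    congr 3
    ring
  · rw [shellDensity, indicator_of_notMem hu, indicator_of_notMem hu, mul_zero]

/-- Only finiteness is compared: `R` kills constants, and the values of `g` on `|z| ≤ 1/2` enter
through a bound that depends on `g`. That compact part is always finite, so the shell estimates
decide. -/
theorem ballIntegral_radialDeriv_lt_top_iff {g : Cn n → ℂ}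
    (hg : DifferentiableOn ℂ g (unitBall n)) {p : ℝ} (hp : 0 < p) {b : ℝ} (hb : -1 < b) :
    ballIntegral (b + p) p (radialDeriv g) < ⊤ ↔ ballIntegral b p g < ⊤ := by
  constructor
  · intro h
    refine ballIntegral_lt_top_of_shell hp hg
      (setLIntegral_shell_lt_top_of_radialDeriv hg hp hb ?_)
    exact (setLIntegral_shell_le_ballIntegral _ _ _).trans_lt
      (ENNReal.mul_lt_top ENNReal.ofReal_lt_top h)
  · intro h
    refine ballIntegral_lt_top_of_shell hp (differentiableOn_radialDeriv hg) ?_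
    obtain ⟨C, hC⟩ := lintegral_shell_radialDeriv_le hg hp hb
    exact hC.trans_lt (ENNReal.mul_lt_top ENNReal.ofReal_lt_top
      ((setLIntegral_shell_le_ballIntegral _ _ _).trans_lt
        (ENNReal.mul_lt_top ENNReal.ofReal_lt_top h)))

/-! ### Independence of the order `k`, and the identification with the Besov space. -/

/-- The quantity `∫ |(1 - |z|²) ^ k R ^ k f| ^ p dτ`. -/
def besovIntegral (p : ℝ) (k : ℕ) (f : Cn n → ℂ) : ENNReal :=
  ballIntegral (p * k - n - 1) p (radialDeriv^[k] f)

theorem besovIntegral_lt_top_iff_of_le {f : Cn n → ℂ} (hf : DifferentiableOn ℂ f (unitBall n))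
    {p : ℝ} (hp : 0 < p) {k m : ℕ} (hk : (n : ℝ) < p * k) (hkm : k ≤ m) :
    besovIntegral p m f < ⊤ ↔ besovIntegral p k f < ⊤ := by
  induction m, hkm using Nat.le_induction with
  | base => rfl
  | succ m hkm ih =>
    rw [← ih, besovIntegral, besovIntegral, Function.iterate_succ_apply']
    have hb : -1 < p * m - n - 1 := by
      have : p * k ≤ p * m := by gcongr
      linarith
    rw [← ballIntegral_radialDeriv_lt_top_iff (differentiableOn_iterate_radialDeriv hf m) hp hb]
    push_cast
    rw [show p * ((m : ℝ) + 1) - n - 1 = p * m - n - 1 + p by ring]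

theorem besovIntegral_lt_top_iff {f : Cn n → ℂ} (hf : DifferentiableOn ℂ f (unitBall n))
    {p : ℝ} (hp : 0 < p) {k m : ℕ} (hk : (n : ℝ) < p * k) (hm : (n : ℝ) < p * m) :
    besovIntegral p m f < ⊤ ↔ besovIntegral p k f < ⊤ := by
  rcases le_total k m with h | h
  · exact besovIntegral_lt_top_iff_of_le hf hp hk h
  · exact (besovIntegral_lt_top_iff_of_le hf hp hm h).symm

theorem lintegral_invariantMeasure_eq {p : ℝ} (hp : 0 < p) (k : ℕ) (f : Cn n → ℂ) :
    ∫⁻ z, ENNReal.ofReal (‖((1 - ‖z‖ ^ 2 : ℝ) : ℂ) ^ k * radialDeriv^[k] f z‖ ^ p)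
      ∂invariantMeasure n = besovIntegral p k f := by
  have hm : Measurable fun z : Cn n => ENNReal.ofReal (1 / (1 - ‖z‖ ^ 2) ^ (n + 1)) := by
    fun_prop
  rw [invariantMeasure, lintegral_withDensity_eq_lintegral_mul_non_measurable _ hm
    (ae_of_all _ fun z => ENNReal.ofReal_lt_top), besovIntegral, ballIntegral]
  refine setLIntegral_congr_fun measurableSet_ball fun z hz => ?_
  have hd := one_sub_norm_sq_pos (mem_unitBall_iff.mp hz)
  simp only [Pi.mul_apply]
  rw [norm_mul, norm_pow, Complex.norm_real, Real.norm_of_nonneg hd.le,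
    Real.mul_rpow (by positivity) (norm_nonneg _), enorm_rpow_eq_ofReal hp.le,
    ← ENNReal.ofReal_mul (by positivity), ← ENNReal.ofReal_mul (by positivity)]
  congr 1
  rw [show p * (k : ℝ) - n - 1 = k * p - ((n + 1 : ℕ) : ℝ) by push_cast; ring, Real.rpow_sub hd,
    Real.rpow_natCast, Real.rpow_mul hd.le, Real.rpow_natCast]
  ring

theorem weightedVolume_eq_invariantMeasure {α : ℝ} (hα : (n : ℝ) + 1 + α = 0) :
    weightedVolume n α = invariantMeasure n := by
  refine withDensity_congr_ae ?_
  filter_upwards [ae_restrict_mem measurableSet_ball] with z hz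
  have hd := one_sub_norm_sq_pos (mem_unitBall_iff.mp hz)
  rw [show α = -((n + 1 : ℕ) : ℝ) by push_cast; linarith, Real.rpow_neg hd.le, Real.rpow_natCast,
    one_div]

theorem memLp_iff_besovIntegral_lt_top {f : Cn n → ℂ} (hf : DifferentiableOn ℂ f (unitBall n))
    {α : ℝ} (hα : (n : ℝ) + 1 + α = 0) {p : ℝ} (hp : 0 < p) (k : ℕ) :
    MemLp (fun z => ((1 - ‖z‖ ^ 2 : ℝ) : ℂ) ^ k * radialDeriv^[k] f z)
      (ENNReal.ofReal p) (weightedVolume n α) ↔ besovIntegral p k f < ⊤ := by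
  have hmeas : AEStronglyMeasurable
      (fun z : Cn n => ((1 - ‖z‖ ^ 2 : ℝ) : ℂ) ^ k * radialDeriv^[k] f z)
      (weightedVolume n α) := by
    refine AEStronglyMeasurable.mono_ac (withDensity_absolutelyContinuous _ _) ?_
    refine ContinuousOn.aestronglyMeasurable ?_ measurableSet_ball
    exact ContinuousOn.mul (by fun_prop) (differentiableOn_iterate_radialDeriv hf k).continuousOn
  rw [MemLp, and_iff_right hmeas, eLpNorm_lt_top_iff_lintegral_rpow_enorm_lt_top
    (by simpa using hp) ENNReal.ofReal_ne_top, ENNReal.toReal_ofReal hp.le,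
    weightedVolume_eq_invariantMeasure hα, ← lintegral_invariantMeasure_eq hp]
  simp only [enorm_rpow_eq_ofReal hp.le]

theorem mem_bergmanSpace_iff {α : ℝ} (hα : (n : ℝ) + 1 + α = 0) {p : ℝ} (hp : 0 < p) {k : ℕ}
    (hk : (n : ℝ) < p * k) {f : Cn n → ℂ} :
    f ∈ bergmanSpace n p α ↔
      DifferentiableOn ℂ f (unitBall n) ∧ besovIntegral p k f < ⊤ := by
  constructor
  · rintro ⟨hf, m, hm, h⟩
    rw [memLp_iff_besovIntegral_lt_top hf hα hp] at h
    exact ⟨hf, (besovIntegral_lt_top_iff hf hp hk (by linarith)).mp h⟩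
  · rintro ⟨hf, h⟩
    exact ⟨hf, k, by linarith, (memLp_iff_besovIntegral_lt_top hf hα hp k).mpr h⟩

theorem bergmanSpace_eq_besovSpace {α : ℝ} (hα : (n : ℝ) + 1 + α = 0) {p : ℝ} (hp : 0 < p) {k : ℕ}
    (hk : (n : ℝ) < p * k) : bergmanSpace n p α = besovSpace n p k := by
  ext f
  rw [mem_bergmanSpace_iff hα hp hk, ← lintegral_invariantMeasure_eq hp]
  rfl

/-! ### Nonisotropic balls and integrals along rays. -/

/-- A nonisotropic neighbourhood of the point `ρ e` of the ball, where `|e| = 1`: its size is of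
order `1 - ρ` in the direction of `e` and of order `√(1 - ρ)` in the orthogonal directions. -/
def nonisotropicBall (e : Cn n) (ρ : ℝ) : Set (Cn n) :=
  {w | ‖w‖ < 1 ∧ ‖inner ℂ e w - (ρ : ℂ)‖ < (1 - ρ) / 4 ∧
    1 - ρ ≤ 4 * (1 - ‖w‖ ^ 2) ∧ 1 - ‖w‖ ^ 2 ≤ 5 / 2 * (1 - ρ)}

theorem measurableSet_nonisotropicBall_prod (e : Cn n) :
    MeasurableSet {q : Cn n × ℝ | q.1 ∈ nonisotropicBall e q.2} := by
  have h1 : MeasurableSet {q : Cn n × ℝ | ‖q.1‖ < 1} :=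
    (isOpen_lt (by fun_prop) (by fun_prop)).measurableSet
  have h2 : MeasurableSet {q : Cn n × ℝ | ‖inner ℂ e q.1 - (q.2 : ℂ)‖ < (1 - q.2) / 4} :=
    (isOpen_lt (by fun_prop) (by fun_prop)).measurableSet
  have h3 : MeasurableSet {q : Cn n × ℝ | 1 - q.2 ≤ 4 * (1 - ‖q.1‖ ^ 2)} :=
    (isClosed_le (by fun_prop) (by fun_prop)).measurableSet
  have h4 : MeasurableSet {q : Cn n × ℝ | 1 - ‖q.1‖ ^ 2 ≤ 5 / 2 * (1 - q.2)} :=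
    (isClosed_le (by fun_prop) (by fun_prop)).measurableSet
  exact h1.inter (h2.inter (h3.inter h4))

theorem measurableSet_nonisotropicBall (e : Cn n) (ρ : ℝ) :
    MeasurableSet (nonisotropicBall e ρ) :=
  (measurableSet_nonisotropicBall_prod e).preimage
    (f := fun w : Cn n => (w, ρ)) (by fun_prop)

/-- Pythagoras: the component along `e` has length at most `ρ + b`, the orthogonal one at most `a`.
Since `a` enters squared, `a` of order `√(1-ρ)` still fits in the ball. -/
theorem norm_sq_add_smul_le {e x : Cn n} (he : ‖e‖ = 1) (hx : ‖x‖ < 1) {ρ a b : ℝ} (hρ : 0 ≤ ρ)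
    (hb : 0 ≤ b) :
    ‖(ρ : ℂ) • e + ((a : ℂ) • x + ((b - a : ℝ) * inner ℂ e x : ℂ) • e)‖ ^ 2 ≤
      (ρ + b) ^ 2 + a ^ 2 := by
  set c : ℂ := inner ℂ e x with hc
  have hee : inner ℂ e e = (1 : ℂ) := by rw [inner_self_eq_norm_sq_to_K, he]; simp
  have hc1 : ‖c‖ ≤ 1 := by
    have := norm_inner_le_norm (𝕜 := ℂ) e x
    rw [he, one_mul] at this
    linarith
  have hsplit : (ρ : ℂ) • e + ((a : ℂ) • x + ((b - a : ℝ) * c) • e) =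
      ((ρ : ℂ) + b * c) • e + (a : ℂ) • (x - c • e) := by
    push_cast
    module
  have horth : inner ℂ (((ρ : ℂ) + b * c) • e) ((a : ℂ) • (x - c • e)) = 0 := by
    rw [inner_smul_left, inner_smul_right, inner_sub_right, inner_smul_right, hee, ← hc, mul_one,
      sub_self, mul_zero, mul_zero]
  have hperp : ‖x - c • e‖ ≤ 1 := by
    have h0 : inner ℂ (c • e) (x - c • e) = 0 := by
      rw [inner_smul_left, inner_sub_right, inner_smul_right, hee, ← hc, mul_one, sub_self,
        mul_zero]
    have h1 := norm_add_sq_eq_norm_sq_add_norm_sq_of_inner_eq_zero (c • e) (x - c • e) h0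
    rw [add_sub_cancel] at h1
    nlinarith [norm_nonneg (x - c • e), norm_nonneg x, mul_self_nonneg ‖c • e‖]
  rw [hsplit, sq, norm_add_sq_eq_norm_sq_add_norm_sq_of_inner_eq_zero _ _ horth, norm_smul,
    norm_smul, he, mul_one, Complex.norm_real]
  have h2 : ‖(ρ : ℂ) + b * c‖ ≤ ρ + b := by
    refine (norm_add_le _ _).trans ?_
    rw [norm_mul, Complex.norm_real, Complex.norm_real, Real.norm_of_nonneg hρ,
      Real.norm_of_nonneg hb]
    nlinarith
  have h3 : (‖a‖ * ‖x - c • e‖) * (‖a‖ * ‖x - c • e‖) ≤ a ^ 2 := by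
    have h4 : ‖a‖ * ‖a‖ = a ^ 2 := by rw [Real.norm_eq_abs, abs_mul_abs_self, sq]
    have h5 : ‖x - c • e‖ * ‖x - c • e‖ ≤ 1 := by nlinarith [norm_nonneg (x - c • e)]
    nlinarith [mul_le_mul_of_nonneg_left h5 (mul_self_nonneg ‖a‖)]
  nlinarith [norm_nonneg ((ρ : ℂ) + b * c)]

theorem enorm_rpow_mul_le_setLIntegral_nonisotropicBall {g : Cn n → ℂ}
    (hg : DifferentiableOn ℂ g (unitBall n)) {p : ℝ} (hp : 0 < p) {e : Cn n} (he : ‖e‖ = 1)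
    {ρ : ℝ} (hρ : 1 / 2 ≤ ρ) (hρ1 : ρ < 1) :
    ‖g (ρ • e)‖ₑ ^ p * (ENNReal.ofReal ((1 - ρ) ^ (n + 1) / 16 ^ n) *
      volume (ball (0 : Cn n) 1)) ≤ ∫⁻ w in nonisotropicBall e ρ, ‖g w‖ₑ ^ p := by
  set δ := 1 - ρ with hδ
  have hδ0 : 0 < δ := by linarith
  set a := √δ / 4 with ha
  set b := δ / 4 with hb
  have ha0 : 0 < a := by positivity
  have ha2 : a ^ 2 = δ / 16 := by rw [ha, div_pow, Real.sq_sqrt hδ0.le]; norm_num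
  have hee : inner ℂ e e = (1 : ℂ) := by rw [inner_self_eq_norm_sq_to_K, he]; simp
  -- Chosen so that `a` times the transvection along `e` multiplies `e` by `b` and its orthogonal
  -- complement by `a`; the determinant is then `a^n · (b/a)`.
  set ℓ : Module.Dual ℂ (Cn n) := (((b - a) / a : ℝ) : ℂ) • (innerSL ℂ e).toLinearMap with hℓ
  have hℓx : ∀ x, ℓ x = (((b - a) / a : ℝ) : ℂ) * inner ℂ e x := fun x => by simp [hℓ]
  set T : Cn n →ₗ[ℂ] Cn n := (a : ℂ) • LinearMap.transvection ℓ e with hT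
  have hTx : ∀ x, T x = (a : ℂ) • x + ((b - a : ℝ) * inner ℂ e x : ℂ) • e := fun x => by
    rw [hT, LinearMap.smul_apply, LinearMap.transvection.apply, hℓx, smul_add, smul_smul,
      ← mul_assoc, ← Complex.ofReal_mul, mul_div_cancel₀ _ ha0.ne']
  have hdet : ‖LinearMap.det T‖ ^ 2 = δ ^ (n + 1) / 16 ^ n := by
    rw [hT, LinearMap.det_smul, LinearMap.transvection.det, hℓx, hee, finrank_euclideanSpace_fin,
      mul_one]
    have h1 : (1 : ℂ) + (((b - a) / a : ℝ) : ℂ) = ((b / a : ℝ) : ℂ) := by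
      rw [sub_div, div_self ha0.ne']; push_cast; ring
    rw [h1, norm_mul, norm_pow, Complex.norm_real, Complex.norm_real, mul_pow, ← pow_mul,
      mul_comm n 2, pow_mul, Real.norm_eq_abs, sq_abs, Real.norm_eq_abs, sq_abs, ha2, div_pow b, ha2,
      hb]
    have h2 : (δ / 4) ^ 2 / (δ / 16) = δ := by field_simp; norm_num
    rw [h2, div_pow, pow_succ]
    ring
  have hmem : ∀ x ∈ ball (0 : Cn n) 1, ρ • e + T x ∈ nonisotropicBall e ρ := fun x hx => by
    have hx1 : ‖x‖ < 1 := by simpa using hx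
    have hc1 : ‖inner ℂ e x‖ < 1 := by
      have := norm_inner_le_norm (𝕜 := ℂ) e x
      rw [he, one_mul] at this
      linarith
    have hin : inner ℂ e (ρ • e + T x) = (ρ : ℂ) + b * inner ℂ e x := by
      rw [hTx, ← Complex.coe_smul, inner_add_right, inner_add_right, inner_smul_right,
        inner_smul_right, inner_smul_right, hee]
      push_cast; ring
    have hsq := norm_sq_add_smul_le he hx1 (ρ := ρ) (a := a) (b := b) (by linarith) (by positivity)
    rw [← hTx, Complex.coe_smul, ha2] at hsq
    have hnear : ‖inner ℂ e (ρ • e + T x) - (ρ : ℂ)‖ < (1 - ρ) / 4 := by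
      rw [hin, add_sub_cancel_left, norm_mul, Complex.norm_real, Real.norm_of_nonneg (by positivity),
        ← hδ, ← hb]
      nlinarith [show 0 < b by positivity]
    -- With `ρ = 1 - δ` this yields `1 - |w|² ≤ 1 - (1 - 5δ/4)² ≤ 5δ/2`, the origin of the constant
    -- `5/2`.
    have hlow : ρ - δ / 4 ≤ ‖ρ • e + T x‖ := by
      have h1 := norm_inner_le_norm (𝕜 := ℂ) e (ρ • e + T x)
      rw [he, one_mul] at h1
      have h2 := norm_sub_norm_le (ρ : ℂ) (inner ℂ e (ρ • e + T x))
      rw [norm_sub_rev, Complex.norm_real, Real.norm_of_nonneg (by linarith)] at h2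
      linarith
    have hup : δ * (7 / 8) ≤ 1 - ‖ρ • e + T x‖ ^ 2 := by
      have : ρ = 1 - δ := by rw [hδ]; ring
      rw [this] at hsq ⊢
      rw [hb] at hsq
      nlinarith
    refine ⟨?_, hnear, ?_, ?_⟩
    · nlinarith [norm_nonneg (ρ • e + T x)]
    · rw [← hδ]; linarith
    · have h3 : ρ = 1 - δ := by rw [hδ]; ring
      rw [← hδ]
      nlinarith
  rw [← hdet]
  refine enorm_rpow_mul_le_setLIntegral volume hp (measurableSet_nonisotropicBall e ρ)
    (hg.mono fun w hw => mem_unitBall_iff.mpr hw.1) ?_ hmem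
  intro h0
  rw [h0, norm_zero] at hdet
  have : 0 < δ ^ (n + 1) / 16 ^ n := by positivity
  norm_num at hdet
  linarith

theorem ofReal_mul_enorm_rpow_le_nonisotropicBall (n : ℕ) (γ : ℝ) :
    ∃ C : ℝ, 0 < C ∧ ∀ p : ℝ, 0 < p → ∀ g : Cn n → ℂ, DifferentiableOn ℂ g (unitBall n) →
      ∀ e : Cn n, ‖e‖ = 1 → ∀ ρ : ℝ, 1 / 2 ≤ ρ → ρ < 1 →
      ENNReal.ofReal ((1 - ρ) ^ (n + 1 + γ)) * ‖g (ρ • e)‖ₑ ^ p ≤ ENNReal.ofReal C *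
        ∫⁻ w in nonisotropicBall e ρ, ENNReal.ofReal ((1 - ‖w‖ ^ 2) ^ γ) * ‖g w‖ₑ ^ p := by
  have hV0 : volume (ball (0 : Cn n) 1) ≠ 0 := (measure_ball_pos volume 0 one_pos).ne'
  have hVt : volume (ball (0 : Cn n) 1) ≠ ⊤ := measure_ball_lt_top.ne
  set V := (volume (ball (0 : Cn n) 1)).toReal with hV
  have hVpos : 0 < V := ENNReal.toReal_pos hV0 hVt
  have hVe : volume (ball (0 : Cn n) 1) = ENNReal.ofReal V := (ENNReal.ofReal_toReal hVt).symm
  refine ⟨16 ^ n / V * 4 ^ |γ|, by positivity, fun p hp g hg e he ρ hρ hρ1 => ?_⟩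
  have hδ0 : 0 < 1 - ρ := by linarith
  have h1 := enorm_rpow_mul_le_setLIntegral_nonisotropicBall hg hp he hρ hρ1
  rw [hVe, ← ENNReal.ofReal_mul (by positivity)] at h1
  have h2 : ENNReal.ofReal ((1 - ρ) ^ γ) * ∫⁻ w in nonisotropicBall e ρ, ‖g w‖ₑ ^ p ≤
      ENNReal.ofReal (4 ^ |γ|) *
        ∫⁻ w in nonisotropicBall e ρ, ENNReal.ofReal ((1 - ‖w‖ ^ 2) ^ γ) * ‖g w‖ₑ ^ p := by
    rw [← lintegral_const_mul' _ _ ENNReal.ofReal_ne_top,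
      ← lintegral_const_mul' _ _ ENNReal.ofReal_ne_top]
    refine setLIntegral_mono' (measurableSet_nonisotropicBall e ρ) fun w hw => ?_
    rw [← mul_assoc]
    exact mul_le_mul_left (ofReal_rpow_le_of_comparable hδ0 (one_sub_norm_sq_pos hw.1)
      (by norm_num) hw.2.2.1 (by linarith [hw.2.2.2]) γ) _
  calc ENNReal.ofReal ((1 - ρ) ^ (n + 1 + γ)) * ‖g (ρ • e)‖ₑ ^ p
      = ENNReal.ofReal (16 ^ n / V) * (ENNReal.ofReal ((1 - ρ) ^ γ) *
          (‖g (ρ • e)‖ₑ ^ p * ENNReal.ofReal ((1 - ρ) ^ (n + 1) / 16 ^ n * V))) := by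
        rw [mul_comm (‖g (ρ • e)‖ₑ ^ p), ← mul_assoc, ← mul_assoc,
          ← ENNReal.ofReal_mul (by positivity), ← ENNReal.ofReal_mul (by positivity)]
        congr 2
        rw [Real.rpow_add hδ0, show (n : ℝ) + 1 = ((n + 1 : ℕ) : ℝ) by push_cast; ring,
          Real.rpow_natCast]
        field_simp
    _ ≤ ENNReal.ofReal (16 ^ n / V) * (ENNReal.ofReal (4 ^ |γ|) *
        ∫⁻ w in nonisotropicBall e ρ, ENNReal.ofReal ((1 - ‖w‖ ^ 2) ^ γ) * ‖g w‖ₑ ^ p) :=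
        mul_le_mul_right ((mul_le_mul_right h1 _).trans h2) _
    _ = _ := by rw [← mul_assoc, ← ENNReal.ofReal_mul (by positivity)]

/-- Bounded overlap: with `x = Re ⟨e, w⟩`, membership of `w` forces `1 - ρ` between `4/5` and `4/3`
of `1 - x`. That interval has `dρ/(1-ρ)` mass at most `(8/15)(5/4) = 2/3`. -/
theorem setLIntegral_one_sub_inv_nonisotropicBall_le (e w : Cn n) :
    ∫⁻ ρ in Iio (1 : ℝ), {ρ : ℝ | w ∈ nonisotropicBall e ρ}.indicator
      (fun ρ => ENNReal.ofReal (1 - ρ)⁻¹) ρ ≤ 1 := by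
  set x := (inner ℂ e w : ℂ).re with hx
  by_cases hx1 : x < 1
  · have hd : 0 < 1 - x := by linarith
    have hle : ∀ ρ ∈ Iio (1 : ℝ), {ρ : ℝ | w ∈ nonisotropicBall e ρ}.indicator
        (fun ρ => ENNReal.ofReal (1 - ρ)⁻¹) ρ ≤
        (Ioo (1 - 4 / 3 * (1 - x)) (1 - 4 / 5 * (1 - x))).indicator
          (fun _ => ENNReal.ofReal (5 / 4 * (1 - x)⁻¹)) ρ := fun ρ hρ => by
      by_cases hw : w ∈ nonisotropicBall e ρ
      · have hρ1 : 0 < 1 - ρ := sub_pos.mpr hρ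
        have h1 := (Complex.abs_re_le_norm _).trans_lt hw.2.1
        rw [Complex.sub_re, Complex.ofReal_re, ← hx, abs_lt] at h1
        have hmem : ρ ∈ Ioo (1 - 4 / 3 * (1 - x)) (1 - 4 / 5 * (1 - x)) :=
          ⟨by linarith [h1.1, h1.2], by linarith [h1.1, h1.2]⟩
        rw [indicator_of_mem hmem]
        refine (indicator_le_self' (fun _ _ => zero_le) ρ).trans (ENNReal.ofReal_le_ofReal ?_)
        rw [← div_eq_mul_inv, inv_eq_one_div, div_le_div_iff₀ hρ1 hd]
        linarith [h1.1]
      · have : ρ ∉ {ρ : ℝ | w ∈ nonisotropicBall e ρ} := hw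
        rw [indicator_of_notMem this]
        exact zero_le
    refine (setLIntegral_mono' measurableSet_Iio hle).trans ((setLIntegral_le_lintegral _ _).trans ?_)
    rw [lintegral_indicator measurableSet_Ioo, setLIntegral_const, Real.volume_Ioo,
      ← ENNReal.ofReal_mul (by positivity), ENNReal.ofReal_le_one]
    field_simp
    linarith
  · refine (setLIntegral_mono' measurableSet_Iio (g := fun _ => 0) fun ρ hρ => ?_).trans (by simp)
    have : ρ ∉ {ρ : ℝ | w ∈ nonisotropicBall e ρ} := fun hw => by
      have hρ1 : 0 < 1 - ρ := sub_pos.mpr hρ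
      have h1 := (Complex.abs_re_le_norm _).trans_lt hw.2.1
      rw [Complex.sub_re, Complex.ofReal_re, ← hx, abs_lt] at h1
      linarith [h1.2]
    rw [indicator_of_notMem this]

/-- The mean value inequality at each `ρe`, integrated against `dρ/(1-ρ)`; by Fubini and bounded
overlap each `w` is counted at most once. Keeping track of `ρ₀` confines the right side to a collar
of the sphere, which makes tails small uniformly in `e`. -/
theorem setLIntegral_ray_le (n : ℕ) (γ : ℝ) :
    ∃ C : ℝ, 0 < C ∧ ∀ p : ℝ, 0 < p → ∀ g : Cn n → ℂ, DifferentiableOn ℂ g (unitBall n) →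
      ∀ e : Cn n, ‖e‖ = 1 → ∀ ρ₀ : ℝ, 1 / 2 ≤ ρ₀ →
      ∫⁻ ρ in Ioo ρ₀ 1, ENNReal.ofReal ((1 - ρ) ^ (n + γ)) * ‖g (ρ • e)‖ₑ ^ p ≤
        ENNReal.ofReal C * ∫⁻ w in unitBall n ∩ {w | 1 - ‖w‖ ^ 2 ≤ 5 / 2 * (1 - ρ₀)},
          ENNReal.ofReal ((1 - ‖w‖ ^ 2) ^ γ) * ‖g w‖ₑ ^ p := by
  obtain ⟨C, hC, hpt⟩ := ofReal_mul_enorm_rpow_le_nonisotropicBall n γ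
  refine ⟨C, hC, fun p hp g hg e he ρ₀ hρ₀ => ?_⟩
  set U : Set (Cn n) := unitBall n ∩ {w | 1 - ‖w‖ ^ 2 ≤ 5 / 2 * (1 - ρ₀)} with hU
  have hUm : MeasurableSet U :=
    measurableSet_ball.inter (measurableSet_le (by fun_prop) (by fun_prop))
  set Φ : Cn n → ENNReal :=
    U.indicator fun w => ENNReal.ofReal ((1 - ‖w‖ ^ 2) ^ γ) * ‖g w‖ₑ ^ p with hΦ
  have hΦm : Measurable Φ := by
    have h1 := measurable_indicator_enorm_rpow hUm (hg.continuousOn.mono inter_subset_left) p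
    have h2 : Measurable fun w : Cn n => ENNReal.ofReal ((1 - ‖w‖ ^ 2) ^ γ) := by fun_prop
    convert h2.mul h1 using 1
    ext w
    by_cases hw : w ∈ U
    · simp only [hΦ, Pi.mul_apply, indicator_of_mem hw]
    · simp only [hΦ, Pi.mul_apply, indicator_of_notMem hw, mul_zero]
  set S : Set (Cn n × ℝ) := {q | q.1 ∈ nonisotropicBall e q.2} with hS
  set H : Cn n × ℝ → ENNReal := S.indicator fun q => Φ q.1 * ENNReal.ofReal (1 - q.2)⁻¹ with hH
  have hHm : Measurable H := by
    refine Measurable.indicator ?_ (measurableSet_nonisotropicBall_prod e)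
    exact (hΦm.comp measurable_fst).mul (by fun_prop)
  have hHeq : ∀ w ρ, H (w, ρ) = Φ w * {ρ : ℝ | w ∈ nonisotropicBall e ρ}.indicator
      (fun ρ => ENNReal.ofReal (1 - ρ)⁻¹) ρ := fun w ρ => by
    by_cases hw : w ∈ nonisotropicBall e ρ
    · have h1 : (w, ρ) ∈ S := hw
      have h2 : ρ ∈ {ρ : ℝ | w ∈ nonisotropicBall e ρ} := hw
      rw [hH, indicator_of_mem h1, indicator_of_mem h2]
    · have h1 : (w, ρ) ∉ S := hw
      have h2 : ρ ∉ {ρ : ℝ | w ∈ nonisotropicBall e ρ} := hw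
      rw [hH, indicator_of_notMem h1, indicator_of_notMem h2, mul_zero]
  have step1 : ∀ ρ ∈ Ioo ρ₀ 1, ENNReal.ofReal ((1 - ρ) ^ (n + γ)) * ‖g (ρ • e)‖ₑ ^ p ≤
      ENNReal.ofReal C * ∫⁻ w, H (w, ρ) := fun ρ hρ => by
    have hδ : 0 < 1 - ρ := by linarith [hρ.2]
    have h1 := hpt p hp g hg e he ρ (by linarith [hρ.1]) hρ.2
    calc _ = ENNReal.ofReal (1 - ρ)⁻¹ *
          (ENNReal.ofReal ((1 - ρ) ^ (n + 1 + γ)) * ‖g (ρ • e)‖ₑ ^ p) := by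
          rw [← mul_assoc, ← ENNReal.ofReal_mul (by positivity)]
          congr 2
          rw [show (n : ℝ) + 1 + γ = n + γ + 1 by ring, Real.rpow_add_one hδ.ne']
          field_simp
      _ ≤ ENNReal.ofReal (1 - ρ)⁻¹ * _ := mul_le_mul_right h1 _
      _ = ENNReal.ofReal C * (ENNReal.ofReal (1 - ρ)⁻¹ * ∫⁻ w in nonisotropicBall e ρ,
            ENNReal.ofReal ((1 - ‖w‖ ^ 2) ^ γ) * ‖g w‖ₑ ^ p) := by ring
      _ ≤ _ := by
          refine mul_le_mul_right ?_ _
          rw [← lintegral_const_mul' _ _ ENNReal.ofReal_ne_top,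
            ← lintegral_indicator (measurableSet_nonisotropicBall e ρ)]
          refine lintegral_mono fun w => ?_
          by_cases hw : w ∈ nonisotropicBall e ρ
          · have h2 : w ∈ U := ⟨mem_unitBall_iff.mpr hw.1, hw.2.2.2.trans (by linarith [hρ.1])⟩
            have h3 : ρ ∈ {ρ : ℝ | w ∈ nonisotropicBall e ρ} := hw
            simp only []
            rw [hHeq, indicator_of_mem hw, indicator_of_mem h3, hΦ, indicator_of_mem h2, mul_comm]
          · rw [indicator_of_notMem hw]
            exact zero_le
  calc _ ≤ ∫⁻ ρ in Ioo ρ₀ 1, ENNReal.ofReal C * ∫⁻ w, H (w, ρ) :=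
        setLIntegral_mono' measurableSet_Ioo step1
    _ ≤ ∫⁻ ρ in Iio 1, ENNReal.ofReal C * ∫⁻ w, H (w, ρ) := lintegral_mono_set Ioo_subset_Iio_self
    _ = ENNReal.ofReal C * ∫⁻ ρ in Iio 1, ∫⁻ w, H (w, ρ) :=
        lintegral_const_mul' _ _ ENNReal.ofReal_ne_top
    _ = ENNReal.ofReal C * ∫⁻ w, ∫⁻ ρ in Iio 1, H (w, ρ) := by
        congr 1
        exact lintegral_lintegral_swap (hHm.comp measurable_swap).aemeasurable
    _ ≤ ENNReal.ofReal C * ∫⁻ w, Φ w := by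
        refine mul_le_mul_right (lintegral_mono fun w => ?_) _
        simp only [hHeq]
        rw [lintegral_const_mul _ (Measurable.indicator (by fun_prop) ?_)]
        · exact (mul_le_mul_right (setLIntegral_one_sub_inv_nonisotropicBall_le e w) _).trans_eq
            (mul_one _)
        · exact (measurableSet_nonisotropicBall_prod e).preimage
            (f := fun ρ : ℝ => (w, ρ)) (by fun_prop)
    _ = _ := by rw [hΦ, lintegral_indicator hUm]

/-! ### Taylor's formula in the logarithm of the radius. -/

/-- The Taylor polynomial in `log r` of degree `m` of `f` along the ray through `e`, expanded at
the radius `ρ` and evaluated at the radius `r`. -/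
def logTaylor (f : Cn n → ℂ) (m : ℕ) (e : Cn n) (r ρ : ℝ) : ℂ :=
  ∑ j ∈ Finset.range (m + 1),
    ((Real.log (r / ρ) ^ j / j.factorial : ℝ) : ℂ) * radialDeriv^[j] f (ρ • e)

theorem hasDerivAt_log_div_pow {r ρ : ℝ} (hr : 0 < r) (hρ : 0 < ρ) (j : ℕ) :
    HasDerivAt (fun ρ => Real.log (r / ρ) ^ (j + 1) / (j + 1).factorial)
      (-(Real.log (r / ρ) ^ j / j.factorial * ρ⁻¹)) ρ := by
  have h1 : HasDerivAt (fun ρ => Real.log (r / ρ)) (-ρ⁻¹) ρ := by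
    have h2 : HasDerivAt (fun ρ => Real.log r - Real.log ρ) (-ρ⁻¹) ρ :=
      (Real.hasDerivAt_log hρ.ne').const_sub _
    refine h2.congr_of_eventuallyEq ?_
    filter_upwards [lt_mem_nhds hρ] with x hx
    exact Real.log_div hr.ne' hx.ne'
  refine ((h1.pow (j + 1)).div_const _).congr_deriv ?_
  rw [Nat.factorial_succ]
  push_cast
  field_simp

/-- As `R = ρ d/dρ` along the ray, differentiating in the centre of expansion telescopes and leaves
only the top term. -/
theorem hasDerivAt_logTaylor {f : Cn n → ℂ} (hf : DifferentiableOn ℂ f (unitBall n))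
    {e : Cn n} (he : ‖e‖ = 1) {r : ℝ} (hr : 0 < r) (m : ℕ) {ρ : ℝ} (hρ0 : 0 < ρ) (hρ1 : ρ < 1) :
    HasDerivAt (logTaylor f m e r)
      (((Real.log (r / ρ) ^ m / m.factorial * ρ⁻¹ : ℝ) : ℂ) *
        radialDeriv^[m + 1] f (ρ • e)) ρ := by
  have hmem : ρ • e ∈ unitBall n := by
    rw [mem_unitBall_iff, norm_smul, he, Real.norm_of_nonneg hρ0.le, mul_one]; exact hρ1
  have hR : ∀ j, HasDerivAt (fun ρ : ℝ => radialDeriv^[j] f (ρ • e))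
      ((ρ : ℂ)⁻¹ * radialDeriv^[j + 1] f (ρ • e)) ρ := fun j => by
    rw [Function.iterate_succ_apply']
    exact hasDerivAt_comp_real_smul (differentiableOn_iterate_radialDeriv hf j) hρ0.ne' hmem
  induction m with
  | zero =>
    have h := hR 0
    unfold logTaylor
    simp only [zero_add, Finset.range_one, Finset.sum_singleton, pow_zero, Nat.factorial_zero,
      Nat.cast_one, div_one, Complex.ofReal_one, one_mul, Complex.ofReal_inv]
    exact h
  | succ m ih =>
    have h1 : logTaylor f (m + 1) e r = fun ρ => logTaylor f m e r ρ +
        ((Real.log (r / ρ) ^ (m + 1) / (m + 1).factorial : ℝ) : ℂ) *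
          radialDeriv^[m + 1] f (ρ • e) := by
      ext x
      rw [logTaylor, Finset.sum_range_succ]
      rfl
    rw [h1]
    refine (ih.add ((hasDerivAt_log_div_pow hr hρ0 m).ofReal_comp.mul (hR (m + 1)))).congr_deriv ?_
    push_cast
    ring

/-- The fundamental theorem of calculus in the centre of expansion, from `ρ₀` to `r`, where the
polynomial reduces to `f(re)`. For `ρ ≥ 1/2` both `log (r/ρ) ≤ 2(1-ρ)` and `ρ⁻¹ ≤ 2`, whence
`2^(m+1)`. -/
theorem enorm_sub_logTaylor_le {f : Cn n → ℂ} (hf : DifferentiableOn ℂ f (unitBall n))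
    {e : Cn n} (he : ‖e‖ = 1) (m : ℕ) {ρ₀ r : ℝ} (hρ₀ : 1 / 2 ≤ ρ₀) (hr : ρ₀ ≤ r) (hr1 : r < 1) :
    ‖f (r • e) - logTaylor f m e r ρ₀‖ₑ ≤ ENNReal.ofReal (2 ^ (m + 1)) *
      ∫⁻ ρ in Ioo ρ₀ r,
        ENNReal.ofReal ((1 - ρ) ^ m) * ‖radialDeriv^[m + 1] f (ρ • e)‖ₑ := by
  have hr0 : 0 < r := by linarith
  have huIcc : uIcc ρ₀ r = Icc ρ₀ r := uIcc_of_le hr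
  have hcont : ContinuousOn (fun ρ : ℝ => ((Real.log (r / ρ) ^ m / m.factorial * ρ⁻¹ : ℝ) : ℂ) *
      radialDeriv^[m + 1] f (ρ • e)) (Icc ρ₀ r) := by
    refine ContinuousOn.mul (Complex.continuous_ofReal.comp_continuousOn ?_) ?_
    · have hne : ∀ x ∈ Icc ρ₀ r, x ≠ 0 := fun x hx => by linarith [hx.1]
      refine ContinuousOn.mul (ContinuousOn.div_const (ContinuousOn.pow ?_ m) _)
        (continuousOn_inv₀.mono fun x hx => hne x hx)
      refine ContinuousOn.log (continuousOn_const.div continuousOn_id hne) fun x hx => ?_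
      exact div_ne_zero hr0.ne' (hne x hx)
    · refine (differentiableOn_iterate_radialDeriv hf (m + 1)).continuousOn.comp (by fun_prop)
        fun x hx => ?_
      rw [mem_unitBall_iff, norm_smul, he, mul_one, Real.norm_of_nonneg (by linarith [hx.1])]
      exact hx.2.trans_lt hr1
  have hftc := intervalIntegral.integral_eq_sub_of_hasDerivAt (a := ρ₀) (b := r)
    (f := logTaylor f m e r)
    (fun ρ hρ => by
      rw [huIcc] at hρ
      exact hasDerivAt_logTaylor hf he hr0 m (by linarith [hρ.1]) (hρ.2.trans_lt hr1))
    (by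
      refine ContinuousOn.intervalIntegrable ?_
      rw [huIcc]; exact hcont)
  have hend : logTaylor f m e r r = f (r • e) := by
    rw [logTaylor, Finset.sum_range_succ', div_self hr0.ne', Real.log_one]
    simp
  rw [hend, intervalIntegral.integral_of_le hr, integral_Ioc_eq_integral_Ioo] at hftc
  rw [← hftc, ← lintegral_const_mul' _ _ ENNReal.ofReal_ne_top]
  refine (enorm_integral_le_lintegral_enorm _).trans ?_
  refine setLIntegral_mono' measurableSet_Ioo fun ρ hρ => ?_
  rw [enorm_mul, ← mul_assoc, ← ENNReal.ofReal_mul (by positivity)]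
  refine mul_le_mul_left ?_ _
  have hρ0 : 0 < ρ := by linarith [hρ.1]
  have h1ρ : 0 < 1 - ρ := by linarith [hρ.2]
  have hlog0 : 0 ≤ Real.log (r / ρ) := Real.log_nonneg ((one_le_div hρ0).mpr hρ.2.le)
  have hlog : Real.log (r / ρ) ≤ 2 * (1 - ρ) := by
    have h1 := Real.log_le_sub_one_of_pos (show 0 < r / ρ by positivity)
    have h2 : r / ρ - 1 ≤ 2 * (1 - ρ) := by
      rw [div_sub_one hρ0.ne', div_le_iff₀ hρ0]
      nlinarith [mul_nonneg h1ρ.le (show 0 ≤ 2 * ρ - 1 by linarith [hρ.1])]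
    linarith
  have hinv : ρ⁻¹ ≤ 2 := by
    rw [inv_le_comm₀ hρ0 (by norm_num)]; linarith [hρ.1]
  rw [← ofReal_norm, Complex.norm_real, Real.norm_of_nonneg (by positivity)]
  refine ENNReal.ofReal_le_ofReal ?_
  have hfac : (1 : ℝ) ≤ m.factorial := by exact_mod_cast m.factorial_pos
  calc Real.log (r / ρ) ^ m / m.factorial * ρ⁻¹ ≤ (2 * (1 - ρ)) ^ m / 1 * 2 := by gcongr
    _ = 2 ^ (m + 1) * (1 - ρ) ^ m := by rw [mul_pow]; ring

theorem exists_norm_rpow_le_besovIntegral (n : ℕ) {p : ℝ} (hp : 0 < p) (k : ℕ) :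
    ∃ C : ℝ, 0 < C ∧ ∀ f : Cn n → ℂ, DifferentiableOn ℂ f (unitBall n) →
      besovIntegral p k f < ⊤ → ∀ e : Cn n, ‖e‖ = 1 → ∀ ρ : ℝ, 1 / 2 ≤ ρ → ρ < 1 →
      ((1 - ρ) ^ k * ‖radialDeriv^[k] f (ρ • e)‖) ^ p ≤ C * (besovIntegral p k f).toReal := by
  obtain ⟨C, hC, h⟩ := ofReal_mul_enorm_rpow_le_nonisotropicBall n (p * k - n - 1)
  refine ⟨C, hC, fun f hf hfin e he ρ hρ hρ1 => ?_⟩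
  have hδ : 0 < 1 - ρ := by linarith
  have h1 := h p hp _ (differentiableOn_iterate_radialDeriv hf k) e he ρ hρ hρ1
  have h2 : ∫⁻ w in nonisotropicBall e ρ, ENNReal.ofReal ((1 - ‖w‖ ^ 2) ^ (p * k - n - 1)) *
      ‖radialDeriv^[k] f w‖ₑ ^ p ≤ ENNReal.ofReal (besovIntegral p k f).toReal := by
    rw [ENNReal.ofReal_toReal hfin.ne]
    exact lintegral_mono_set fun w hw => mem_unitBall_iff.mpr hw.1
  have h3 := h1.trans (mul_le_mul_right h2 _)
  rw [enorm_rpow_eq_ofReal hp.le, ← ENNReal.ofReal_mul (by positivity),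
    ← ENNReal.ofReal_mul (by positivity), ENNReal.ofReal_le_ofReal_iff (by positivity)] at h3
  refine le_trans (le_of_eq ?_) h3
  rw [Real.mul_rpow (by positivity) (norm_nonneg _), ← Real.rpow_natCast, ← Real.rpow_mul hδ.le]
  congr 2
  ring

/-! ### Continuous extension to the closed ball for `p ≤ 1`. -/

theorem exists_setLIntegral_lt {Φ : Cn n → ENNReal} (hΦ : ∫⁻ w in unitBall n, Φ w < ⊤)
    {ε : ENNReal} (hε : 0 < ε) :
    ∃ ρ₀ : ℝ, 1 / 2 ≤ ρ₀ ∧ ρ₀ < 1 ∧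
      ∫⁻ w in unitBall n ∩ {w | 1 - ‖w‖ ^ 2 ≤ 5 / 2 * (1 - ρ₀)}, Φ w < ε := by
  set ν := (volume.restrict (unitBall n)).withDensity Φ with hν
  -- Collars for `ρ₀ = 1 - 1/(j+2)`, the shift by `2` keeping `ρ₀ ≥ 1/2`. They decrease to the empty
  -- set, so their mass for a finite measure tends to `0`.
  set U : ℕ → Set (Cn n) := fun j =>
    unitBall n ∩ {w | 1 - ‖w‖ ^ 2 ≤ 5 / 2 * (1 - (1 - 1 / ((j : ℝ) + 2)))} with hU
  have hUm : ∀ j, MeasurableSet (U j) := fun j =>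
    measurableSet_ball.inter (measurableSet_le (by fun_prop) (by fun_prop))
  have hanti : Antitone U := fun i j hij w hw => by
    have h0 : 1 - ‖w‖ ^ 2 ≤ 5 / 2 * (1 - (1 - 1 / ((j : ℝ) + 2))) := hw.2
    refine ⟨hw.1, h0.trans ?_⟩
    have h1 : (i : ℝ) ≤ j := by exact_mod_cast hij
    have h2 : 1 / ((j : ℝ) + 2) ≤ 1 / ((i : ℝ) + 2) := by gcongr
    linarith
  have hfin : ν (U 0) ≠ ⊤ := by
    refine ne_top_of_le_ne_top hΦ.ne ((measure_mono (subset_univ _)).trans_eq ?_)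
    rw [hν, withDensity_apply _ MeasurableSet.univ, Measure.restrict_univ]
  have hempty : ⋂ j, U j = ∅ := by
    refine eq_empty_of_forall_notMem fun w hw => ?_
    rw [mem_iInter] at hw
    have h1 := one_sub_norm_sq_pos (mem_unitBall_iff.mp (hw 0).1)
    obtain ⟨j, hj⟩ := exists_nat_gt (5 / 2 / (1 - ‖w‖ ^ 2))
    have h2 : 1 - ‖w‖ ^ 2 ≤ 5 / 2 * (1 - (1 - 1 / ((j : ℝ) + 2))) := (hw j).2
    rw [div_lt_iff₀ h1] at hj
    have h3 : (1 - ‖w‖ ^ 2) * ((j : ℝ) + 2) ≤ 5 / 2 := by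
      rw [sub_sub_cancel, mul_one_div, le_div_iff₀ (by positivity)] at h2
      exact h2
    nlinarith
  have hlim := tendsto_measure_iInter_atTop (μ := ν) (fun j => (hUm j).nullMeasurableSet) hanti
    ⟨0, hfin⟩
  rw [hempty, measure_empty] at hlim
  obtain ⟨j, hj⟩ := (hlim.eventually (gt_mem_nhds hε)).exists
  have hj2 : 1 / ((j : ℝ) + 2) ≤ 1 / 2 := by
    gcongr
    linarith [Nat.cast_nonneg (α := ℝ) j]
  refine ⟨1 - 1 / ((j : ℝ) + 2), by linarith, by
    have : 0 < 1 / ((j : ℝ) + 2) := by positivity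
    linarith, lt_of_eq_of_lt ?_ hj⟩
  rw [Function.comp_apply, hν, withDensity_apply _ (hUm j), Measure.restrict_restrict (hUm j),
    inter_eq_self_of_subset_left (show U j ⊆ unitBall n from inter_subset_left)]

/-- For `p ≤ 1` the factor `((1-ρ)^(m+1) |R^(m+1) f|)^(1-p)` is bounded, so the Taylor remainder is
dominated by the ray integral of the `p`-th power. Over a thin collar that integral is small for all
`e` at once. -/
theorem exists_forall_norm_sub_logTaylor_le {p : ℝ} (hp : 0 < p) (hp1 : p ≤ 1) {m : ℕ}
    {f : Cn n → ℂ} (hf : DifferentiableOn ℂ f (unitBall n))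
    (hfin : besovIntegral p (m + 1) f < ⊤) {ε : ℝ} (hε : 0 < ε) :
    ∃ ρ₀ : ℝ, 1 / 2 ≤ ρ₀ ∧ ρ₀ < 1 ∧ ∀ e : Cn n, ‖e‖ = 1 → ∀ r : ℝ, ρ₀ ≤ r → r < 1 →
      ‖f (r • e) - logTaylor f m e r ρ₀‖ ≤ ε := by
  obtain ⟨C, hC, hpt⟩ := exists_norm_rpow_le_besovIntegral n hp (m + 1)
  obtain ⟨C', hC', hray⟩ := setLIntegral_ray_le n (p * (m + 1 : ℕ) - n - 1)
  -- The summand `1` keeps `A`, and hence `D`, positive even if the integral vanishes.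
  set A := (C * (besovIntegral p (m + 1) f).toReal) ^ (1 / p) + 1 with hA
  have hA0 : 0 < A := by positivity
  set D := 2 ^ (m + 1) * A ^ (1 - p) * C' with hD
  have hD0 : 0 < D := by positivity
  obtain ⟨ρ₀, h1, h2, h3⟩ := exists_setLIntegral_lt (n := n)
    (Φ := fun w => ENNReal.ofReal ((1 - ‖w‖ ^ 2) ^ (p * (m + 1 : ℕ) - n - 1)) *
      ‖radialDeriv^[m + 1] f w‖ₑ ^ p) hfin (ε := ENNReal.ofReal (ε / D))
    (ENNReal.ofReal_pos.mpr (by positivity))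
  refine ⟨ρ₀, h1, h2, fun e he r hr hr1 => ?_⟩
  have hG := differentiableOn_iterate_radialDeriv hf (m + 1)
  set G := radialDeriv^[m + 1] f with hGdef
  have hbound : ∀ ρ ∈ Ioo ρ₀ r, ENNReal.ofReal ((1 - ρ) ^ m) * ‖G (ρ • e)‖ₑ ≤
      ENNReal.ofReal (A ^ (1 - p)) * (ENNReal.ofReal ((1 - ρ) ^ (n + (p * (m + 1 : ℕ) - n - 1))) *
        ‖G (ρ • e)‖ₑ ^ p) := fun ρ hρ => by
    have hδ : 0 < 1 - ρ := by linarith [hρ.2]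
    have h4 := hpt f hf hfin e he ρ (by linarith [hρ.1]) (by linarith [hρ.2])
    set y := ‖G (ρ • e)‖ with hy
    have hy0 : 0 ≤ y := norm_nonneg _
    have h5 : (1 - ρ) ^ (m + 1) * y ≤ A := by
      have h6 := Real.rpow_le_rpow (by positivity) h4 (show 0 ≤ 1 / p by positivity)
      rw [← Real.rpow_mul (by positivity), mul_one_div_cancel hp.ne', Real.rpow_one] at h6
      linarith
    rw [enorm_rpow_eq_ofReal hp.le, ← ofReal_norm, ← hy, ← ENNReal.ofReal_mul (by positivity),
      ← ENNReal.ofReal_mul (by positivity), ← ENNReal.ofReal_mul (by positivity)]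
    refine ENNReal.ofReal_le_ofReal ?_
    rcases hy0.eq_or_lt with hy1 | hy1
    · rw [← hy1]; simp [Real.zero_rpow hp.ne']
    have h7 : (1 - ρ) ^ m * y = ((1 - ρ) ^ (m + 1) * y) ^ (1 - p) *
        ((1 - ρ) ^ (n + (p * (m + 1 : ℕ) - n - 1)) * y ^ p) := by
      have h8 : (1 - ρ) ^ (n + (p * (m + 1 : ℕ) - n - 1)) * y ^ p =
          ((1 - ρ) ^ (m + 1) * y) ^ p * (1 - ρ)⁻¹ := by
        rw [Real.mul_rpow (by positivity) hy0, ← Real.rpow_natCast (1 - ρ) (m + 1),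
          ← Real.rpow_mul hδ.le, show (n : ℝ) + (p * (m + 1 : ℕ) - n - 1) =
            ((m + 1 : ℕ) : ℝ) * p - 1 by ring, Real.rpow_sub_one hδ.ne']
        ring
      rw [h8, ← mul_assoc, ← Real.rpow_add (by positivity), sub_add_cancel, Real.rpow_one]
      field_simp
      ring
    rw [h7]
    have := Real.rpow_le_rpow (by positivity) h5 (sub_nonneg.mpr hp1)
    gcongr
  have hmain : ‖f (r • e) - logTaylor f m e r ρ₀‖ₑ ≤ ENNReal.ofReal ε := by
    calc _ ≤ ENNReal.ofReal (2 ^ (m + 1)) *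
          ∫⁻ ρ in Ioo ρ₀ r, ENNReal.ofReal ((1 - ρ) ^ m) * ‖G (ρ • e)‖ₑ :=
          enorm_sub_logTaylor_le hf he m h1 hr hr1
      _ ≤ ENNReal.ofReal (2 ^ (m + 1)) * ∫⁻ ρ in Ioo ρ₀ r, ENNReal.ofReal (A ^ (1 - p)) *
          (ENNReal.ofReal ((1 - ρ) ^ (n + (p * (m + 1 : ℕ) - n - 1))) * ‖G (ρ • e)‖ₑ ^ p) :=
          mul_le_mul_right (setLIntegral_mono' measurableSet_Ioo hbound) _
      _ ≤ ENNReal.ofReal (2 ^ (m + 1)) * (ENNReal.ofReal (A ^ (1 - p)) * ∫⁻ ρ in Ioo ρ₀ 1,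
          ENNReal.ofReal ((1 - ρ) ^ (n + (p * (m + 1 : ℕ) - n - 1))) * ‖G (ρ • e)‖ₑ ^ p) := by
          rw [lintegral_const_mul' _ _ ENNReal.ofReal_ne_top]
          exact mul_le_mul_right (mul_le_mul_right
            (lintegral_mono_set (Ioo_subset_Ioo_right hr1.le)) _) _
      _ ≤ ENNReal.ofReal (2 ^ (m + 1)) * (ENNReal.ofReal (A ^ (1 - p)) *
          (ENNReal.ofReal C' * ENNReal.ofReal (ε / D))) :=
          mul_le_mul_right (mul_le_mul_right ((hray p hp G hG e he ρ₀ h1).trans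
            (mul_le_mul_right h3.le _)) _) _
      _ = ENNReal.ofReal ε := by
          rw [← ENNReal.ofReal_mul (by positivity), ← ENNReal.ofReal_mul (by positivity),
            ← ENNReal.ofReal_mul (by positivity)]
          congr 1
          rw [hD]
          field_simp
  rw [← ofReal_norm, ENNReal.ofReal_le_ofReal_iff hε.le] at hmain
  exact hmain

theorem continuousAt_logTaylor {f : Cn n → ℂ} (hf : DifferentiableOn ℂ f (unitBall n)) (m : ℕ)
    {ρ₀ : ℝ} (h0 : 0 < ρ₀) (h1 : ρ₀ < 1) {z : Cn n} (hz : z ≠ 0) :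
    ContinuousAt (fun z : Cn n => logTaylor f m (‖z‖⁻¹ • z) ‖z‖ ρ₀) z := by
  have hn : ‖z‖ ≠ 0 := norm_ne_zero_iff.mpr hz
  have he : ContinuousAt (fun z : Cn n => ρ₀ • ‖z‖⁻¹ • z) z :=
    ((continuousAt_id.norm.inv₀ hn).smul continuousAt_id).const_smul ρ₀
  have hmem : ρ₀ • ‖z‖⁻¹ • z ∈ unitBall n := by
    rw [mem_unitBall_iff, norm_smul, norm_smul, norm_inv, norm_norm, inv_mul_cancel₀ hn, mul_one,
      Real.norm_of_nonneg h0.le]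
    exact h1
  have hlog : ContinuousAt (fun z : Cn n => Real.log (‖z‖ / ρ₀)) z :=
    (continuousAt_id.norm.div_const ρ₀).log (div_ne_zero hn h0.ne')
  unfold logTaylor
  refine tendsto_finsetSum _ fun j _ => ?_
  refine ContinuousAt.mul (Complex.continuous_ofReal.continuousAt.comp
    ((hlog.pow j).div_const _)) ?_
  exact ContinuousAt.comp (f := fun z : Cn n => ρ₀ • ‖z‖⁻¹ • z)
    (((differentiableOn_iterate_radialDeriv hf j).continuousOn.continuousAt
    (isOpen_ball.mem_nhds hmem))) he

/-- Near a boundary point `ζ`, `f` is within `ε/4` of its Taylor polynomial at `ρ₀`, which is a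
continuous function of `z` across the sphere. So `f` satisfies the Cauchy criterion at `ζ`. -/
theorem exists_continuousOn_extension {p : ℝ} (hp : 0 < p) (hp1 : p ≤ 1) {m : ℕ}
    {f : Cn n → ℂ} (hf : DifferentiableOn ℂ f (unitBall n))
    (hfin : besovIntegral p (m + 1) f < ⊤) :
    ∃ F : Cn n → ℂ, ContinuousOn F (closedBall 0 1) ∧ EqOn F f (unitBall n) := by
  have hcl : closedBall (0 : Cn n) 1 ⊆ closure (unitBall n) := by
    rw [unitBall, closure_ball _ one_ne_zero]
  have hin : ∀ z ∈ unitBall n, Filter.Tendsto f (nhdsWithin z (unitBall n)) (nhds (f z)) :=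
    fun z hz => hf.continuousOn z hz
  refine ⟨extendFrom (unitBall n) f, continuousOn_extendFrom hcl fun ζ hζ => ?_, fun z hz =>
    extendFrom_eq (subset_closure hz) (hin z hz)⟩
  by_cases hζ1 : ζ ∈ unitBall n
  · exact ⟨f ζ, hin ζ hζ1⟩
  have hζn : ‖ζ‖ = 1 := by
    rw [mem_unitBall_iff, not_lt] at hζ1
    exact le_antisymm (by simpa using hζ) hζ1
  have hne : (nhdsWithin ζ (unitBall n)).NeBot := mem_closure_iff_nhdsWithin_neBot.mp (hcl hζ)
  rw [← cauchy_map_iff_exists_tendsto, Metric.cauchy_iff]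
  refine ⟨hne.map f, fun ε hε => ?_⟩
  obtain ⟨ρ₀, h1, h2, h3⟩ := exists_forall_norm_sub_logTaylor_le hp hp1 hf hfin
    (show 0 < ε / 4 by positivity)
  have hζ0 : ζ ≠ 0 := norm_ne_zero_iff.mp (by rw [hζn]; exact one_ne_zero)
  have hcont := continuousAt_logTaylor hf m (by linarith) h2 hζ0
  set P : Cn n → ℂ := fun z => logTaylor f m (‖z‖⁻¹ • z) ‖z‖ ρ₀ with hP
  have hev1 : ∀ᶠ z in nhds ζ, ‖P z - P ζ‖ < ε / 8 := by
    have := Metric.tendsto_nhds.mp hcont (ε / 8) (by positivity)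
    simpa only [dist_eq_norm] using this
  have hev2 : ∀ᶠ z in nhds ζ, ρ₀ < ‖z‖ :=
    continuous_norm.continuousAt.eventually (lt_mem_nhds (h2.trans_eq hζn.symm))
  have hev : ∀ᶠ z in nhdsWithin ζ (unitBall n),
      z ∈ unitBall n ∧ ‖P z - P ζ‖ < ε / 8 ∧ ρ₀ < ‖z‖ := by
    filter_upwards [self_mem_nhdsWithin, nhdsWithin_le_nhds hev1, nhdsWithin_le_nhds hev2]
      with z h4 h5 h6 using ⟨h4, h5, h6⟩
  refine ⟨f '' {z | z ∈ unitBall n ∧ ‖P z - P ζ‖ < ε / 8 ∧ ρ₀ < ‖z‖},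
    Filter.image_mem_map hev, ?_⟩
  have hclose : ∀ z, (z ∈ unitBall n ∧ ‖P z - P ζ‖ < ε / 8 ∧ ρ₀ < ‖z‖) →
      ‖f z - P ζ‖ < ε / 2 := fun z hz => by
    have hr : 0 < ‖z‖ := by linarith [hz.2.2]
    have h7 := h3 (‖z‖⁻¹ • z) (by rw [norm_smul, norm_inv, norm_norm, inv_mul_cancel₀ hr.ne'])
      ‖z‖ hz.2.2.le (mem_unitBall_iff.mp hz.1)
    rw [smul_smul, mul_inv_cancel₀ hr.ne', one_smul] at h7
    have h8 : ‖f z - P ζ‖ ≤ ‖f z - P z‖ + ‖P z - P ζ‖ := norm_sub_le_norm_sub_add_norm_sub _ _ _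
    have h9 := hz.2.1
    linarith
  rintro _ ⟨x, hx, rfl⟩ _ ⟨y, hy, rfl⟩
  rw [dist_eq_norm]
  have h4 := hclose x hx
  have h5 := hclose y hy
  rw [norm_sub_rev] at h5
  have := norm_sub_le_norm_sub_add_norm_sub (f x) (P ζ) (f y)
  linarith

theorem exists_continuousOn_extension_of_mem_bergmanSpace {α : ℝ} (hα : (n : ℝ) + 1 + α = 0)
    {p : ℝ} (hp : 0 < p) (hp1 : p ≤ 1) {f : Cn n → ℂ} (hf : f ∈ bergmanSpace n p α) :
    ∃ F : Cn n → ℂ, ContinuousOn F (closedBall 0 1) ∧ EqOn F f (unitBall n) := by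
  obtain ⟨m, hm⟩ := exists_nat_gt ((n : ℝ) / p)
  rw [div_lt_iff₀ hp] at hm
  have hk : (n : ℝ) < p * (m + 1 : ℕ) := by push_cast; nlinarith
  obtain ⟨hd, hfin⟩ := (mem_bergmanSpace_iff hα hp hk).mp hf
  exact exists_continuousOn_extension hp hp1 hd hfin

/-! ### Logarithmic growth for `p > 1`. -/

theorem radialDeriv_zero (g : Cn n → ℂ) : radialDeriv g 0 = 0 := by
  rw [radialDeriv_eq_fderiv, map_zero]

/-- On the slice `φ(l) = g(lw)` one has `R g(lw) = l φ'(l)`, so `|φ'| ≤ M` on the unit circle, and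
in the disc by the maximum principle. Integrating from `0` to `1` loses no constant. -/
theorem norm_sub_apply_zero_le {g : Cn n → ℂ} (hg : DifferentiableOn ℂ g (unitBall n)) {M : ℝ}
    (hM : ∀ w, ‖w‖ = 1 / 2 → ‖radialDeriv g w‖ ≤ M) {w : Cn n} (hw : ‖w‖ = 1 / 2) :
    ‖g w - g 0‖ ≤ M := by
  set φ : ℂ → ℂ := fun l => g (l • w) with hφ
  have hmem : ∀ l ∈ ball (0 : ℂ) 2, l • w ∈ unitBall n := fun l hl => by
    have hl : ‖l‖ < 2 := by simpa using hl
    rw [mem_unitBall_iff, norm_smul, hw]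
    linarith
  have hd : DifferentiableOn ℂ φ (ball 0 2) := hg.comp (by fun_prop) hmem
  have hsub : closedBall (0 : ℂ) 1 ⊆ ball 0 2 := closedBall_subset_ball (by norm_num)
  have hderiv : ∀ l ∈ sphere (0 : ℂ) 1, ‖deriv φ l‖ ≤ M := fun l hl => by
    have hl1 : ‖l‖ = 1 := by simpa using hl
    have h1 := hasFDerivAt_of_mem_unitBall hg (hmem l (hsub (sphere_subset_closedBall hl)))
    have h2 : HasDerivAt (fun l : ℂ => l • w) ((1 : ℂ) • w) l := (hasDerivAt_id l).smul_const w
    have h3 : deriv φ l = fderiv ℂ g (l • w) ((1 : ℂ) • w) := (h1.comp_hasDerivAt l h2).deriv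
    have h4 : radialDeriv g (l • w) = l * deriv φ l := by
      rw [h3, radialDeriv_eq_fderiv, one_smul, map_smul, smul_eq_mul]
    have h5 := hM (l • w) (by rw [norm_smul, hl1, one_mul, hw])
    rwa [h4, norm_mul, hl1, one_mul] at h5
  have hbd : ∀ l ∈ closedBall (0 : ℂ) 1, ‖deriv φ l‖ ≤ M := fun l hl => by
    refine Complex.norm_le_of_forall_mem_frontier_norm_le (U := ball (0 : ℂ) 1) isBounded_ball
      ((hd.deriv isOpen_ball).diffContOnCl_ball hsub) (fun y hy => ?_) ?_
    · rw [frontier_ball _ one_ne_zero] at hy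
      exact hderiv y hy
    · rwa [closure_ball _ one_ne_zero]
  have h := (convex_closedBall (0 : ℂ) 1).norm_image_sub_le_of_norm_deriv_le
    (fun l hl => hd.differentiableAt (isOpen_ball.mem_nhds (hsub hl))) hbd
    (show (0 : ℂ) ∈ closedBall 0 1 by simp) (show (1 : ℂ) ∈ closedBall 0 1 by simp)
  simpa [hφ] using h

/-- Descending induction on the order. All `R^i f` with `i ≥ 1` vanish at the origin, so `f 0` is
the only initial value that enters, as in the norm. -/
theorem norm_iterate_radialDeriv_le {f : Cn n → ℂ} (hf : DifferentiableOn ℂ f (unitBall n))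
    {m : ℕ} {M : ℝ} (hM : ∀ w, ‖w‖ = 1 / 2 → ‖radialDeriv^[m + 1] f w‖ ≤ M) {j : ℕ} (hj : j ≤ m)
    {w : Cn n} (hw : ‖w‖ = 1 / 2) : ‖radialDeriv^[j] f w‖ ≤ ‖f 0‖ + M := by
  have key : ∀ i ≤ m, ∀ w, ‖w‖ = 1 / 2 → ‖radialDeriv^[i + 1] f w‖ ≤ M := fun i hi => by
    induction hi using Nat.decreasingInduction with
    | self => exact hM
    | of_succ i hi ih =>
      intro w hw
      have h1 := norm_sub_apply_zero_le (differentiableOn_iterate_radialDeriv hf (i + 1))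
        (M := M) (fun w hw => by
          rw [← Function.iterate_succ_apply' (f := radialDeriv)]
          exact ih w hw) hw
      rw [Function.iterate_succ_apply', radialDeriv_zero, sub_zero] at h1
      rw [Function.iterate_succ_apply']
      exact h1
  rcases j with _ | j
  · have h1 := norm_sub_apply_zero_le hf (key 0 (Nat.zero_le m)) hw
    have h2 : ‖f w‖ ≤ ‖f w - f 0‖ + ‖f 0‖ := by simpa using norm_add_le (f w - f 0) (f 0)
    exact h2.trans (by linarith)
  · have := key j (by omega) w hw
    linarith [norm_nonneg (f 0)]

theorem setLIntegral_one_sub_inv {r : ℝ} (hr : 1 / 2 ≤ r) (hr1 : r < 1) :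
    ∫⁻ ρ in Ioo (1 / 2) r, ENNReal.ofReal (1 - ρ)⁻¹ =
      ENNReal.ofReal (Real.log (1 / 2 / (1 - r))) := by
  have hc : ContinuousOn (fun ρ : ℝ => (1 - ρ)⁻¹) (uIcc (1 / 2) r) := by
    rw [uIcc_of_le hr]
    refine ContinuousOn.inv₀ (by fun_prop) fun x hx => ?_
    linarith [hx.2]
  have hv : ∫ ρ in (1 / 2)..r, (1 - ρ)⁻¹ = Real.log (1 / 2 / (1 - r)) := by
    rw [intervalIntegral.integral_comp_sub_left (fun x => x⁻¹) 1,
      integral_inv_of_pos (by linarith) (by norm_num)]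
    norm_num
  rw [← hv, intervalIntegral.integral_of_le hr, integral_Ioc_eq_integral_Ioo,
    ofReal_integral_eq_lintegral_ofReal]
  · exact hc.intervalIntegrable.1.mono_set Ioo_subset_Ioc_self
  · exact (ae_restrict_mem measurableSet_Ioo).mono fun x hx =>
      inv_nonneg.mpr (by linarith [hx.2])

/-- Hölder's inequality for the Taylor remainder, splitting `m = (m + 1 - 1/p) - 1/q`. The first
factor gives the ray integral with weight `(1-ρ)^(p(m+1)-1)`, the second `∫ dρ/(1-ρ)`. -/
theorem exists_enorm_sub_logTaylor_le_log (n : ℕ) {p q : ℝ} (hpq : p.HolderConjugate q) (m : ℕ) :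
    ∃ C : ℝ, 0 < C ∧ ∀ f : Cn n → ℂ, DifferentiableOn ℂ f (unitBall n) →
      besovIntegral p (m + 1) f < ⊤ → ∀ e : Cn n, ‖e‖ = 1 → ∀ r : ℝ, 1 / 2 ≤ r → r < 1 →
      ‖f (r • e) - logTaylor f m e r (1 / 2)‖ ≤
        C * (besovIntegral p (m + 1) f).toReal ^ (1 / p) *
          Real.log (2 / (1 - r ^ 2)) ^ (1 / q) := by
  have hp := hpq.pos
  have hq := hpq.symm.pos
  obtain ⟨C, hC, hray⟩ := setLIntegral_ray_le n (p * (m + 1 : ℕ) - n - 1)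
  refine ⟨2 ^ (m + 1) * C ^ (1 / p), by positivity, fun f hf hfin e he r hr hr1 => ?_⟩
  have hG := differentiableOn_iterate_radialDeriv hf (m + 1)
  set G := radialDeriv^[m + 1] f with hGdef
  set J := besovIntegral p (m + 1) f with hJ
  have hJe : J = ENNReal.ofReal J.toReal := (ENNReal.ofReal_toReal hfin.ne).symm
  set L := Real.log (2 / (1 - r ^ 2)) with hL
  have h1r : 0 < 1 - r := by linarith
  have h1r2 : 0 < 1 - r ^ 2 := by nlinarith
  have hLle : Real.log (1 / 2 / (1 - r)) ≤ L := by
    refine Real.log_le_log (by positivity) ?_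
    rw [div_le_div_iff₀ h1r h1r2]
    nlinarith
  have hL0 : 0 ≤ L := Real.log_nonneg (by rw [le_div_iff₀ h1r2]; nlinarith)
  set u : ℝ → ENNReal := fun ρ => ENNReal.ofReal ((1 - ρ) ^ (m + 1 - 1 / p)) * ‖G (ρ • e)‖ₑ with hu
  set v : ℝ → ENNReal := fun ρ => ENNReal.ofReal ((1 - ρ) ^ (-(1 / q))) with hv
  have hum : AEMeasurable u (volume.restrict (Ioo (1 / 2) r)) := by
    have h1 : Measurable fun ρ : ℝ => ENNReal.ofReal ((1 - ρ) ^ (m + 1 - 1 / p)) := by fun_prop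
    refine h1.aemeasurable.mul (ContinuousOn.aemeasurable ?_ measurableSet_Ioo)
    refine ContinuousOn.enorm (hG.continuousOn.comp (by fun_prop) fun x hx => ?_)
    rw [mem_unitBall_iff, norm_smul, he, mul_one, Real.norm_of_nonneg (by linarith [hx.1])]
    exact hx.2.trans hr1
  have hvm : AEMeasurable v (volume.restrict (Ioo (1 / 2) r)) := by fun_prop
  have hholder := ENNReal.lintegral_mul_le_Lp_mul_Lq _ hpq hum hvm
  have huv : ∫⁻ ρ in Ioo (1 / 2) r, ENNReal.ofReal ((1 - ρ) ^ m) * ‖G (ρ • e)‖ₑ =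
      ∫⁻ ρ in Ioo (1 / 2) r, (u * v) ρ := by
    refine setLIntegral_congr_fun measurableSet_Ioo fun ρ hρ => ?_
    have hδ : 0 < 1 - ρ := by linarith [hρ.2]
    simp only [hu, hv, Pi.mul_apply]
    rw [mul_right_comm, ← ENNReal.ofReal_mul (by positivity), ← Real.rpow_add hδ,
      ← Real.rpow_natCast]
    congr 3
    have := hpq.inv_add_inv_eq_one
    rw [one_div, one_div]
    linarith
  have hup : ∫⁻ ρ in Ioo (1 / 2) r, u ρ ^ p ≤ ENNReal.ofReal (C * J.toReal) := by
    have h1 := hray p hp G hG e he (1 / 2) le_rfl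
    refine le_trans ?_ (h1.trans ?_)
    · refine le_trans (setLIntegral_mono' measurableSet_Ioo fun ρ hρ => le_of_eq ?_)
        (lintegral_mono_set (Ioo_subset_Ioo_right hr1.le))
      have hδ : 0 < 1 - ρ := by linarith [hρ.2]
      simp only [hu]
      rw [ENNReal.mul_rpow_of_nonneg _ _ hp.le, ENNReal.ofReal_rpow_of_nonneg (by positivity) hp.le,
        ← Real.rpow_mul hδ.le]
      congr 3
      push_cast
      field_simp
      ring
    · rw [ENNReal.ofReal_mul hC.le, ← hJe]
      exact mul_le_mul_right (lintegral_mono_set inter_subset_left) _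
  have hvq : ∫⁻ ρ in Ioo (1 / 2) r, v ρ ^ q ≤ ENNReal.ofReal L := by
    refine le_trans (le_of_eq ?_) (ENNReal.ofReal_le_ofReal hLle)
    rw [← setLIntegral_one_sub_inv hr hr1]
    refine setLIntegral_congr_fun measurableSet_Ioo fun ρ hρ => ?_
    have hδ : 0 < 1 - ρ := by linarith [hρ.2]
    simp only [hv]
    rw [ENNReal.ofReal_rpow_of_nonneg (by positivity) hq.le, ← Real.rpow_mul hδ.le, neg_mul,
      one_div_mul_cancel hq.ne', Real.rpow_neg_one]
  have hmain : ‖f (r • e) - logTaylor f m e r (1 / 2)‖ₑ ≤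
      ENNReal.ofReal (2 ^ (m + 1) * C ^ (1 / p) * J.toReal ^ (1 / p) * L ^ (1 / q)) := by
    calc _ ≤ ENNReal.ofReal (2 ^ (m + 1)) *
          ∫⁻ ρ in Ioo (1 / 2) r, ENNReal.ofReal ((1 - ρ) ^ m) * ‖G (ρ • e)‖ₑ :=
          enorm_sub_logTaylor_le hf he m le_rfl hr hr1
      _ ≤ ENNReal.ofReal (2 ^ (m + 1)) * (ENNReal.ofReal (C * J.toReal) ^ (1 / p) *
          ENNReal.ofReal L ^ (1 / q)) := by
          rw [huv]
          refine mul_le_mul_right (hholder.trans ?_) _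
          exact mul_le_mul' (ENNReal.rpow_le_rpow hup (by positivity))
            (ENNReal.rpow_le_rpow hvq (by positivity))
      _ = _ := by
          rw [ENNReal.ofReal_rpow_of_nonneg (by positivity) (by positivity),
            ENNReal.ofReal_rpow_of_nonneg hL0 (by positivity),
            ← ENNReal.ofReal_mul (by positivity), ← ENNReal.ofReal_mul (by positivity),
            Real.mul_rpow hC.le ENNReal.toReal_nonneg]
          congr 1
          ring
  rw [← ofReal_norm, ENNReal.ofReal_le_ofReal_iff (by positivity)] at hmain
  exact hmain

theorem exists_norm_le_log (hn : 0 < n) {p q : ℝ} (hpq : p.HolderConjugate q) (m : ℕ) :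
    ∃ C : ℝ, 0 < C ∧ ∀ f : Cn n → ℂ, DifferentiableOn ℂ f (unitBall n) →
      besovIntegral p (m + 1) f < ⊤ → ∀ z ∈ unitBall n,
      ‖f z‖ ≤ C * (‖f 0‖ + (besovIntegral p (m + 1) f).toReal ^ (1 / p)) *
        Real.log (2 / (1 - ‖z‖ ^ 2)) ^ (1 / q) := by
  have hp := hpq.pos
  have hq := hpq.symm.pos
  obtain ⟨C₁, hC₁, h₁⟩ := exists_norm_rpow_le_besovIntegral n hp (m + 1)
  obtain ⟨C₂, hC₂, h₂⟩ := exists_enorm_sub_logTaylor_le_log n hpq m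
  set A := 1 + 2 ^ (m + 1) * C₁ ^ (1 / p) with hA
  have hA0 : 0 < A := by positivity
  have hlog2 : 0 < Real.log 2 := Real.log_pos one_lt_two
  -- The logarithm is at least `log 2` on the ball, so `B` times its power is at least `1` and
  -- absorbs every bounded term.
  set B := (Real.log 2 ^ (1 / q))⁻¹ with hB
  have hB0 : 0 < B := by positivity
  refine ⟨(m + 1) * A * B + C₂, by positivity, fun f hf hfin z hz => ?_⟩
  set Q := (besovIntegral p (m + 1) f).toReal ^ (1 / p) with hQ
  have hQ0 : 0 ≤ Q := by positivity
  have hf0 := norm_nonneg (f 0)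
  set L := Real.log (2 / (1 - ‖z‖ ^ 2)) with hL
  have hz1 : ‖z‖ < 1 := mem_unitBall_iff.mp hz
  have hd := one_sub_norm_sq_pos hz1
  have hL2 : Real.log 2 ≤ L := by
    refine Real.log_le_log (by norm_num) ?_
    rw [le_div_iff₀ hd]
    nlinarith [sq_nonneg ‖z‖]
  have hBL : 1 ≤ B * L ^ (1 / q) := by
    rw [hB, ← div_eq_inv_mul, one_le_div (by positivity)]
    exact Real.rpow_le_rpow hlog2.le hL2 (by positivity)
  have hLq : 0 ≤ L ^ (1 / q) := by
    have : 0 ≤ L := by linarith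
    positivity
  have hsph : ∀ j ≤ m, ∀ w : Cn n, ‖w‖ = 1 / 2 → ‖radialDeriv^[j] f w‖ ≤ A * (‖f 0‖ + Q) := by
    intro j hj w hw
    have hM : ∀ w : Cn n, ‖w‖ = 1 / 2 →
        ‖radialDeriv^[m + 1] f w‖ ≤ 2 ^ (m + 1) * C₁ ^ (1 / p) * Q := fun w hw => by
      -- The growth bound at radius `1/2` in the direction `2w`; there `(1-ρ)^(m+1) = 2^(-(m+1))`.
      have h3 := h₁ f hf hfin ((2 : ℝ) • w) (by rw [norm_smul, hw]; norm_num) (1 / 2) le_rfl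
        (by norm_num)
      rw [smul_smul, one_div, inv_mul_cancel₀ two_ne_zero, one_smul] at h3
      have h4 := Real.rpow_le_rpow (by positivity) h3 (show 0 ≤ 1 / p by positivity)
      rw [← Real.rpow_mul (by positivity), mul_one_div_cancel hp.ne', Real.rpow_one,
        Real.mul_rpow hC₁.le ENNReal.toReal_nonneg, ← hQ] at h4
      have h5 : (2 : ℝ) ^ (m + 1) * (1 - 2⁻¹) ^ (m + 1) = 1 := by
        rw [← mul_pow]; norm_num
      calc ‖radialDeriv^[m + 1] f w‖
          = 2 ^ (m + 1) * ((1 - 2⁻¹) ^ (m + 1) * ‖radialDeriv^[m + 1] f w‖) := by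
            rw [← mul_assoc, h5, one_mul]
        _ ≤ 2 ^ (m + 1) * (C₁ ^ (1 / p) * Q) := by gcongr
        _ = _ := by ring
    refine (norm_iterate_radialDeriv_le hf hM hj hw).trans ?_
    rw [hA, add_mul, one_mul, mul_add]
    have : 0 ≤ 2 ^ (m + 1) * C₁ ^ (1 / p) * ‖f 0‖ := by positivity
    linarith
  have hAN : 0 ≤ A * (‖f 0‖ + Q) := by positivity
  rcases le_or_gt ‖z‖ (1 / 2) with hz2 | hz2
  -- The inner ball is handled by the maximum principle from the sphere `|w| = 1/2`, which is
  -- nonempty because `n > 0`.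
  · have : Nonempty (Fin n) := ⟨⟨0, hn⟩⟩
    have h3 : ‖f z‖ ≤ A * (‖f 0‖ + Q) := by
      refine Complex.norm_le_of_forall_mem_frontier_norm_le (U := ball (0 : Cn n) (1 / 2))
        isBounded_ball (hf.diffContOnCl_ball (closedBall_subset_ball (by norm_num)))
        (fun y hy => ?_) ?_
      · rw [frontier_ball _ (by norm_num)] at hy
        exact hsph 0 (Nat.zero_le m) y (by simpa using hy)
      · rw [closure_ball _ (by norm_num)]
        simpa using hz2
    calc ‖f z‖ ≤ A * (‖f 0‖ + Q) * 1 := by rw [mul_one]; exact h3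
      _ ≤ (A * (‖f 0‖ + Q)) * (B * L ^ (1 / q)) := by gcongr
      _ = (0 + 1) * (A * B * (‖f 0‖ + Q) * L ^ (1 / q)) + 0 * (‖f 0‖ + Q) * L ^ (1 / q) := by ring
      _ ≤ (m + 1) * (A * B * (‖f 0‖ + Q) * L ^ (1 / q)) + C₂ * (‖f 0‖ + Q) * L ^ (1 / q) := by
          have : (0 : ℝ) ≤ m := Nat.cast_nonneg m
          gcongr
      _ = _ := by ring
  · have hr : 0 < ‖z‖ := by linarith
    set e := ‖z‖⁻¹ • z with he
    have hen : ‖e‖ = 1 := by rw [he, norm_smul, norm_inv, norm_norm, inv_mul_cancel₀ hr.ne']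
    have hze : ‖z‖ • e = z := by rw [he, smul_smul, mul_inv_cancel₀ hr.ne', one_smul]
    have h3 := h₂ f hf hfin e hen ‖z‖ hz2.le hz1
    rw [hze, ← hQ, ← hL] at h3
    have h4 : ‖logTaylor f m e ‖z‖ (1 / 2)‖ ≤ (m + 1) * (A * (‖f 0‖ + Q)) := by
      rw [logTaylor]
      refine (norm_sum_le _ _).trans ?_
      have hl0 : 0 ≤ Real.log (‖z‖ / (1 / 2)) :=
        Real.log_nonneg (by rw [le_div_iff₀ (by norm_num)]; linarith)
      have hl1 : Real.log (‖z‖ / (1 / 2)) ≤ 1 := by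
        have := Real.log_le_sub_one_of_pos (show 0 < ‖z‖ / (1 / 2) by positivity)
        have h5 : ‖z‖ / (1 / 2) = 2 * ‖z‖ := by ring
        rw [h5] at this ⊢
        linarith
      refine (Finset.sum_le_card_nsmul _ _ (A * (‖f 0‖ + Q)) fun j hj => ?_).trans ?_
      · rw [norm_mul, Complex.norm_real, Real.norm_of_nonneg (by positivity)]
        have hfac : (1 : ℝ) ≤ j.factorial := by exact_mod_cast j.factorial_pos
        have h6 : Real.log (‖z‖ / (1 / 2)) ^ j / j.factorial ≤ 1 := by
          rw [div_le_one (by positivity)]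
          exact (pow_le_one₀ hl0 hl1).trans hfac
        have h7 := hsph j (by rw [Finset.mem_range] at hj; omega) ((1 / 2 : ℝ) • e)
          (by rw [norm_smul, hen]; norm_num)
        calc _ ≤ 1 * (A * (‖f 0‖ + Q)) := mul_le_mul h6 h7 (norm_nonneg _) zero_le_one
          _ = _ := one_mul _
      · rw [Finset.card_range, nsmul_eq_mul]
        push_cast
        exact le_rfl
    have h5 : ‖f z‖ ≤ ‖f z - logTaylor f m e ‖z‖ (1 / 2)‖ + ‖logTaylor f m e ‖z‖ (1 / 2)‖ := by
      simpa using norm_add_le (f z - logTaylor f m e ‖z‖ (1 / 2)) (logTaylor f m e ‖z‖ (1 / 2))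
    calc ‖f z‖ ≤ C₂ * Q * L ^ (1 / q) + (m + 1) * (A * (‖f 0‖ + Q)) * 1 := by linarith
      _ ≤ C₂ * (‖f 0‖ + Q) * L ^ (1 / q) +
          (m + 1) * (A * (‖f 0‖ + Q)) * (B * L ^ (1 / q)) := by
          have h8 : Q ≤ ‖f 0‖ + Q := by linarith
          gcongr
      _ = _ := by ring

/-! ### The norm of the space, and assembly of the three statements. -/

theorem bergmanNorm_eq {α : ℝ} (hα : (n : ℝ) + 1 + α = 0) {p : ℝ} (hp : 0 < p) {f : Cn n → ℂ}
    (hf : DifferentiableOn ℂ f (unitBall n)) {N : ℕ} (hN : N = sInf {N : ℕ | -1 < p * N + α}) :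
    bergmanNorm n p α f = ‖f 0‖ + (besovIntegral p N f).toReal ^ (1 / p) := by
  have hball : ∀ᵐ z ∂invariantMeasure n, z ∈ unitBall n :=
    (withDensity_absolutelyContinuous _ _).ae_le (ae_restrict_mem measurableSet_ball)
  have hint : ∫ z, (1 - ‖z‖ ^ 2) ^ (p * N) * ‖radialDeriv^[N] f z‖ ^ p ∂weightedVolume n α =
      (besovIntegral p N f).toReal := by
    rw [weightedVolume_eq_invariantMeasure hα, integral_eq_lintegral_of_nonneg_ae,
      ← lintegral_invariantMeasure_eq hp]
    · congr 1
      refine lintegral_congr_ae ?_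
      filter_upwards [hball] with z hz
      have hd := one_sub_norm_sq_pos (mem_unitBall_iff.mp hz)
      rw [norm_mul, norm_pow, Complex.norm_real, Real.norm_of_nonneg hd.le,
        Real.mul_rpow (by positivity) (norm_nonneg _), mul_comm p, Real.rpow_mul hd.le,
        Real.rpow_natCast]
    · filter_upwards [hball] with z hz
      have hd := one_sub_norm_sq_pos (mem_unitBall_iff.mp hz)
      simp only [Pi.zero_apply]
      positivity
    · refine AEStronglyMeasurable.mono_ac (withDensity_absolutelyContinuous _ _) ?_
      refine ContinuousOn.aestronglyMeasurable ?_ measurableSet_ball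
      refine ContinuousOn.mul (ContinuousOn.rpow_const (by fun_prop) fun z hz => Or.inl ?_)
        (ContinuousOn.rpow_const (differentiableOn_iterate_radialDeriv hf N).continuousOn.norm
          fun z hz => Or.inr hp.le)
      exact (one_sub_norm_sq_pos (mem_unitBall_iff.mp hz)).ne'
  rw [bergmanNorm, ← hN, hint]

end

theorem mainTheorem12 (n : ℕ) (hn : 0 < n) (α : ℝ) (hα : (n : ℝ) + 1 + α = 0) :
    (∀ p : ℝ, 0 < p → ∀ k : ℕ, 0 < k → (n : ℝ) < p * k →
      bergmanSpace n p α = besovSpace n p k) ∧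
    (∀ p : ℝ, 0 < p → p ≤ 1 → ∀ f ∈ bergmanSpace n p α,
      (∃ F : Cn n → ℂ, ContinuousOn F (Metric.closedBall 0 1) ∧ Set.EqOn F f (unitBall n)) ∧
      ∃ M : ℝ, ∀ z ∈ unitBall n, ‖f z‖ ≤ M) ∧
    (∀ p q : ℝ, 1 < p → 1 / p + 1 / q = 1 →
      ∃ C : ℝ, 0 < C ∧ ∀ f ∈ bergmanSpace n p α, ∀ z ∈ unitBall n,
        ‖f z‖ ≤ C * bergmanNorm n p α f * (Real.log (2 / (1 - ‖z‖ ^ 2))) ^ (1 / q)) := by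
  refine ⟨fun p hp k _ hk => bergmanSpace_eq_besovSpace hα hp hk, fun p hp hp1 f hf => ?_,
    fun p q hp hpq => ?_⟩
  · obtain ⟨F, hF, hFf⟩ := exists_continuousOn_extension_of_mem_bergmanSpace hα hp hp1 hf
    refine ⟨⟨F, hF, hFf⟩, ?_⟩
    obtain ⟨M, hM⟩ := (isCompact_closedBall (0 : Cn n) 1).exists_bound_of_continuousOn hF
    refine ⟨M, fun z hz => ?_⟩
    rw [← hFf hz]
    exact hM z (ball_subset_closedBall hz)
  · have hp0 : 0 < p := by linarith
    have hconj : p.HolderConjugate q := by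
      rw [Real.holderConjugate_iff]
      exact ⟨hp, by simpa using hpq⟩
    obtain ⟨K, hK⟩ := exists_nat_gt ((n : ℝ) / p)
    rw [div_lt_iff₀ hp0] at hK
    have hNmem : sInf {N : ℕ | -1 < p * N + α} ∈ {N : ℕ | -1 < p * N + α} :=
      Nat.sInf_mem ⟨K, by show -1 < p * (K : ℝ) + α; linarith⟩
    obtain ⟨N, hN⟩ : ∃ N, N = sInf {N : ℕ | -1 < p * N + α} := ⟨_, rfl⟩
    rw [← hN] at hNmem
    have hNp : (n : ℝ) < p * N := by
      have : -1 < p * (N : ℝ) + α := hNmem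
      linarith
    -- The growth estimate is applied with `k = N`, the very order in the norm. No comparison
    -- between different orders is needed, so the constant does not depend on `f`.
    obtain ⟨m, rfl⟩ : ∃ m, N = m + 1 := by
      refine Nat.exists_eq_succ_of_ne_zero fun h0 => ?_
      rw [h0, Nat.cast_zero, mul_zero] at hNp
      exact absurd hNp (not_lt.mpr (Nat.cast_nonneg n))
    obtain ⟨C, hC, h⟩ := exists_norm_le_log hn hconj m
    refine ⟨C, hC, fun f hf z hz => ?_⟩
    obtain ⟨hd, hfin⟩ := (mem_bergmanSpace_iff hα hp0 hNp).mp hf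
    rw [bergmanNorm_eq hα hp0 hd hN]
    exact h f hd hfin z hz
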